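/- Call the level of a rational matrix $Q\in\mathbb{Q}^{n\times n}$ the least integer $m\ge 1$ such that $mQ$ has integer entries, and let $\mathbb{O}_3(\ell,\mathbb{Q})$ be the set of all orthogonal matrices $Q\in\mathbb{Q}^{3\times 3}$ of level $\ell$. Fix an integer $\ell\ge 2$. Then $\mathbb{O}_3(\ell,\mathbb{Q})\neq\emptyset$ if and only if $\ell$ is odd. In that case, $\mathbb{O}_3(\ell,\mathbb{Q})$ is finite, and if $X$ is a random symmetric $3\times 3$ integer matrix whose upper-triangular entries $X_{i,j}$, $i\le j$, have independent and uniformly distributed reductions in $\mathbb{Z}/\ell^2\mathbb{Z}$, then the number $$N_3(\ell)=\#\{Q\in\mathbb{O}_3(\ell,\mathbb{Q}) : Q^{\mathsf T}XQ\in\mathbb{Z}^{3\times 3}\}$$ is an integrable random variable with $$\mathbb{E}[N_3(\ell)]=\frac{48}{\ell^2}\prod_{p\mid\ell}\Bigl(1+\frac1p\Bigr),$$ where the product runs over the distinct prime divisors of $\ell$. -/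

import Mathlib

open MeasureTheory ProbabilityTheory

/-- A rational matrix has all its entries in `ℤ`. -/
def IsIntegerMatrix {n : ℕ} (A : Matrix (Fin n) (Fin n) ℚ) : Prop :=
  ∃ B : Matrix (Fin n) (Fin n) ℤ, A = B.map (Int.cast : ℤ → ℚ)

/-- `ℓ` is the level of the rational matrix `Q`: the least positive integer such that `ℓ • Q` has
integer entries. -/
def IsLevel {n : ℕ} (Q : Matrix (Fin n) (Fin n) ℚ) (ℓ : ℕ) : Prop :=
  IsLeast {m : ℕ | 1 ≤ m ∧ IsIntegerMatrix ((m : ℚ) • Q)} ℓ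

/-- The set of rational orthogonal `n × n` matrices of level `ℓ`. -/
def rationalOrthogonal (n ℓ : ℕ) : Set (Matrix (Fin n) (Fin n) ℚ) :=
  {Q | Q ∈ Matrix.orthogonalGroup (Fin n) ℚ ∧ IsLevel Q ℓ}

/-- The number of rational orthogonal matrices `Q` of level `ℓ` such that `Qᵀ X Q` is again an
integer matrix. (The set being counted is a subset of `rationalOrthogonal n ℓ`, which is finite.) -/
noncomputable def conjugacyCount (n ℓ : ℕ) (X : Matrix (Fin n) (Fin n) ℤ) : ℕ :=
  Set.ncard {Q : Matrix (Fin n) (Fin n) ℚ |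
    Q ∈ rationalOrthogonal n ℓ ∧
      IsIntegerMatrix (Q.transpose * X.map (Int.cast : ℤ → ℚ) * Q)}

/-- `X` is a random symmetric integer `n × n` matrix, defined on the probability space `(Ω, μ)`,
whose upper-triangular entries `X i j`, `i ≤ j`, have independent and uniformly distributed
reductions modulo `m`. -/
structure IsSymmUniformMod {Ω : Type*} [MeasurableSpace Ω] (μ : Measure Ω) (n m : ℕ)
    (X : Ω → Matrix (Fin n) (Fin n) ℤ) : Prop where
  measurable : ∀ i j, Measurable fun ω => X ω i j
  symm : ∀ᵐ ω ∂μ, (X ω).IsSymm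
  indep : iIndepFun
    (fun (p : {p : Fin n × Fin n // p.1 ≤ p.2}) (ω : Ω) => (X ω p.1.1 p.1.2 : ZMod m)) μ
  uniform : ∀ i j, i ≤ j → ∀ a : ZMod m, μ {ω | (X ω i j : ZMod m) = a} = (m : ENNReal)⁻¹

/-! Multiplying by `ℓ` turns `Q` into a primitive integer matrix `M` with `MᵀM = ℓ²`. If `ℓ` is
even, each column has norm divisible by 4, so every entry is even and `M` is not primitive.

For odd `ℓ`, `M` is governed by its reduction modulo `ℓ`. Since `adj M = ±ℓ Mᵀ`, all 2 × 2 minors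
vanish modulo `ℓ`, so the column space is a line spanned by a unimodular vector, isotropic for `x² +
y² + z²`. Count the pairs `(M, v)` with `v` a unimodular isotropic vector on the line of `M`. Each
`M` has `φ(ℓ)` such `v` (`ncard_isotropic_mulVec`). Each `v` has 48 such `M` (`ncard_mulVec_eq`):
two of them differ by a signed permutation matrix on the right, and one exists by
`exists_primitiveSimilitude_mulVec`. There are `φ(ℓ) ℓ ∏ (1 + 1/p)` vectors `v`
(`card_isotropicVectors_eq`), hence `48 ℓ ∏ (1 + 1/p)` matrices `M`.

Existence reduces to prime level. There the `p`-neighbour of `ℤ³` attached to `v` is a unimodular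
lattice of rank 3, and Minkowski's theorem gives it an orthonormal basis
(`exists_similitude_mul_eq`); `p` times that basis forms the columns of `M`.

For fixed `M`, choose `v = M a` unimodular. For symmetric `X`, the congruence `MᵀXM ≡ 0` modulo `ℓ²`
is equivalent to `MᵀXv ≡ 0` (`dvd_conj_apply`), that is, to `Xv ∈ Mℤ³`. As `Xv` is uniform modulo
`ℓ²` and `Mℤ³` has index `|det M| = ℓ³`, this has probability `ℓ⁻³`
(`exists_addSubgroup_eq_conjKernel`). Linearity of expectation finishes. -/

open scoped Matrix

/-! ### Integral model of rational orthogonal matrices -/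

/-- The primitive integer matrices `M` with `Mᵀ M = ℓ²`: the matrices `ℓ • Q` for `Q` rational
orthogonal of level `ℓ`. -/
def primitiveSimilitudes (ℓ : ℕ) : Set (Matrix (Fin 3) (Fin 3) ℤ) :=
  {M | M.transpose * M = ((ℓ : ℤ) ^ 2) • (1 : Matrix (Fin 3) (Fin 3) ℤ) ∧
    ∀ p : ℕ, p.Prime → p ∣ ℓ → ∃ i j, ¬ (p : ℤ) ∣ M i j}

/-- The rational matrix `M / ℓ`. -/
noncomputable def ratScale (ℓ : ℕ) (M : Matrix (Fin 3) (Fin 3) ℤ) : Matrix (Fin 3) (Fin 3) ℚ :=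
  (ℓ : ℚ)⁻¹ • M.map (Int.cast : ℤ → ℚ)

lemma map_intCast_injective {m n : Type*} :
    Function.Injective (fun M : Matrix m n ℤ => M.map (Int.cast : ℤ → ℚ)) :=
  Matrix.map_injective Int.cast_injective

lemma ratScale_injective {ℓ : ℕ} (hℓ : ℓ ≠ 0) : Function.Injective (ratScale ℓ) := by
  intro A B h
  apply map_intCast_injective
  have hl : (ℓ : ℚ)⁻¹ ≠ 0 := inv_ne_zero (by exact_mod_cast hℓ)
  exact smul_right_injective _ hl h

lemma map_intCast_mul (A B : Matrix (Fin 3) (Fin 3) ℤ) :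
    (A * B).map (Int.cast : ℤ → ℚ) = A.map Int.cast * B.map Int.cast :=
  Matrix.map_mul (f := Int.castRingHom ℚ)

lemma transpose_ratScale_mul_mul_ratScale (ℓ : ℕ) (A B X : Matrix (Fin 3) (Fin 3) ℤ) :
    (ratScale ℓ A).transpose * X.map (Int.cast : ℤ → ℚ) * ratScale ℓ B =
      ((ℓ : ℚ)⁻¹ ^ 2) • (A.transpose * X * B).map (Int.cast : ℤ → ℚ) := by
  rw [map_intCast_mul, map_intCast_mul, ratScale, ratScale, Matrix.transpose_smul,
    Matrix.smul_mul, Matrix.smul_mul, Matrix.mul_smul, smul_smul, pow_two, Matrix.transpose_map]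

lemma ratScale_mem_orthogonalGroup_iff {ℓ : ℕ} (hℓ : ℓ ≠ 0) (M : Matrix (Fin 3) (Fin 3) ℤ) :
    ratScale ℓ M ∈ Matrix.orthogonalGroup (Fin 3) ℚ ↔
      M.transpose * M = ((ℓ : ℤ) ^ 2) • (1 : Matrix (Fin 3) (Fin 3) ℤ) := by
  have hl : (ℓ : ℚ) ≠ 0 := by exact_mod_cast hℓ
  rw [Matrix.mem_orthogonalGroup_iff']
  have h := transpose_ratScale_mul_mul_ratScale ℓ M M 1
  rw [Matrix.map_one _ (by simp) (by simp), mul_one, mul_one] at h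
  rw [h, ← map_intCast_injective.eq_iff]
  have h1 : ((((ℓ : ℤ) ^ 2) • (1 : Matrix (Fin 3) (Fin 3) ℤ)).map (Int.cast : ℤ → ℚ)) =
      ((ℓ : ℚ) ^ 2) • (1 : Matrix (Fin 3) (Fin 3) ℚ) := by
    ext i j
    simp only [Matrix.map_apply, Matrix.smul_apply, Matrix.one_apply, smul_eq_mul]
    split_ifs <;> simp
  simp only [h1]
  constructor
  · intro h2
    rw [← h2, smul_smul]
    field_simp
    simp
  · intro h2
    rw [h2, smul_smul]
    field_simp
    simp

/-- With `m / ℓ` in lowest terms, a prime dividing the denominator would divide every entry of `M`,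
against primitivity. -/
lemma dvd_of_isIntegerMatrix_smul_ratScale {ℓ : ℕ} (hℓ : ℓ ≠ 0) {M : Matrix (Fin 3) (Fin 3) ℤ}
    (hM : M ∈ primitiveSimilitudes ℓ) {m : ℕ}
    (h : IsIntegerMatrix ((m : ℚ) • ratScale ℓ M)) : ℓ ∣ m := by
  obtain ⟨B, hB⟩ := h
  have hl : (ℓ : ℚ) ≠ 0 := by exact_mod_cast hℓ
  have key : ∀ i j, (m : ℤ) * M i j = ℓ * B i j := by
    intro i j
    have := congrFun (congrFun hB i) j
    simp only [ratScale, Matrix.smul_apply, Matrix.map_apply, smul_eq_mul] at this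
    have h2 : (m : ℚ) * M i j = ℓ * B i j := by
      rw [← this]; field_simp
    exact_mod_cast h2
  have hg : 0 < Nat.gcd m ℓ := Nat.gcd_pos_of_pos_right _ (Nat.pos_of_ne_zero hℓ)
  obtain ⟨g, m', l', hgp, hco, hm, hl'⟩ := Nat.exists_coprime' hg
  by_cases h1 : l' = 1
  · rw [hm, hl', h1, one_mul]; exact dvd_mul_left _ _
  exfalso
  obtain ⟨p, hp, hpl⟩ := Nat.exists_prime_and_dvd h1
  obtain ⟨i, j, hij⟩ := hM.2 p hp (hl' ▸ hpl.mul_right _)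
  have h3 := key i j
  rw [hm, hl'] at h3
  push_cast at h3
  have hg0 : ((Nat.gcd m ℓ : ℕ) : ℤ) ≠ 0 := by exact_mod_cast hg.ne'
  have hgg : (g : ℤ) ≠ 0 := by exact_mod_cast hgp.ne'
  have h4 : (m' : ℤ) * M i j = l' * B i j := by
    apply mul_left_cancel₀ hgg
    linear_combination h3
  have h5 : (p : ℤ) ∣ m' * M i j := h4 ▸ (Int.natCast_dvd_natCast.2 hpl).mul_right _
  rcases (Nat.prime_iff_prime_int.1 hp).dvd_or_dvd h5 with h6 | h6
  · have : p ∣ 1 := hco ▸ Nat.dvd_gcd (Int.natCast_dvd_natCast.1 h6) hpl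
    exact hp.one_lt.ne' (Nat.dvd_one.1 this)
  · exact hij h6

lemma rationalOrthogonal_eq_image {ℓ : ℕ} (hℓ : ℓ ≠ 0) :
    rationalOrthogonal 3 ℓ = ratScale ℓ '' primitiveSimilitudes ℓ := by
  have hl : (ℓ : ℚ) ≠ 0 := by exact_mod_cast hℓ
  ext Q
  constructor
  · rintro ⟨hQ, ⟨-, M, hM⟩, hmin⟩
    have hQM : ratScale ℓ M = Q := by
      rw [ratScale, ← hM, smul_smul, inv_mul_cancel₀ hl, one_smul]
    refine ⟨M, ⟨(ratScale_mem_orthogonalGroup_iff hℓ M).1 (hQM ▸ hQ), ?_⟩, hQM⟩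
    rintro p hp ⟨k, rfl⟩
    by_contra! hcon
    choose N hN using hcon
    have hk : k ≠ 0 := by rintro rfl; simp at hℓ
    -- If `p` divided all entries, `k = ℓ / p` would already clear the denominators of `Q`.
    have hkle : p * k ≤ k := by
      refine hmin ⟨Nat.one_le_iff_ne_zero.2 hk, Matrix.of N, ?_⟩
      ext i j
      simp only [← hQM, ratScale, Matrix.smul_apply, Matrix.map_apply, smul_eq_mul, hN,
        Matrix.of_apply]
      push_cast at hl ⊢
      have : (k : ℚ) ≠ 0 := by exact_mod_cast hk
      have : (p : ℚ) ≠ 0 := by exact_mod_cast hp.ne_zero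
      field_simp
    have := hp.two_le
    nlinarith [Nat.pos_of_ne_zero hk]
  · rintro ⟨M, hM, rfl⟩
    refine ⟨(ratScale_mem_orthogonalGroup_iff hℓ M).2 hM.1,
      ⟨Nat.one_le_iff_ne_zero.2 hℓ, M, ?_⟩, ?_⟩
    · rw [ratScale, smul_smul, mul_inv_cancel₀ hl, one_smul]
    · rintro m ⟨hm, hmi⟩
      exact Nat.le_of_dvd hm (dvd_of_isIntegerMatrix_smul_ratScale hℓ hM hmi)

lemma isIntegerMatrix_inv_sq_smul_iff {ℓ : ℕ} (hℓ : ℓ ≠ 0) (A : Matrix (Fin 3) (Fin 3) ℤ) :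
    IsIntegerMatrix (((ℓ : ℚ)⁻¹ ^ 2) • A.map (Int.cast : ℤ → ℚ)) ↔
      ∀ i j, ((ℓ : ℤ) ^ 2) ∣ A i j := by
  have hl : (ℓ : ℚ) ≠ 0 := by exact_mod_cast hℓ
  constructor
  · rintro ⟨B, hB⟩ i j
    have := congrFun (congrFun hB i) j
    simp only [Matrix.smul_apply, Matrix.map_apply, smul_eq_mul] at this
    refine ⟨B i j, ?_⟩
    have h2 : (A i j : ℚ) = ℓ ^ 2 * B i j := by
      rw [← this]; field_simp
    exact_mod_cast h2
  · intro h
    choose B hB using h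
    refine ⟨Matrix.of B, ?_⟩
    ext i j
    simp only [Matrix.smul_apply, Matrix.map_apply, smul_eq_mul, hB, Matrix.of_apply]
    push_cast
    field_simp

lemma conjugacyCount_eq_ncard {ℓ : ℕ} (hℓ : ℓ ≠ 0) (X : Matrix (Fin 3) (Fin 3) ℤ) :
    conjugacyCount 3 ℓ X = Set.ncard {M | M ∈ primitiveSimilitudes ℓ ∧
      ∀ i j, ((ℓ : ℤ) ^ 2) ∣ (M.transpose * X * M) i j} := by
  rw [conjugacyCount, ← Set.ncard_image_of_injective _ (ratScale_injective hℓ),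
    rationalOrthogonal_eq_image hℓ]
  congr 1
  ext Q
  constructor
  · rintro ⟨⟨M, hM, rfl⟩, h⟩
    rw [transpose_ratScale_mul_mul_ratScale, isIntegerMatrix_inv_sq_smul_iff hℓ] at h
    exact ⟨M, ⟨hM, h⟩, rfl⟩
  · rintro ⟨M, ⟨hM, h⟩, rfl⟩
    refine ⟨⟨M, hM, rfl⟩, ?_⟩
    rwa [transpose_ratScale_mul_mul_ratScale, isIntegerMatrix_inv_sq_smul_iff hℓ]

lemma sum_sq_col {ℓ : ℕ} {M : Matrix (Fin 3) (Fin 3) ℤ}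
    (hM : M.transpose * M = ((ℓ : ℤ) ^ 2) • (1 : Matrix (Fin 3) (Fin 3) ℤ)) (j : Fin 3) :
    M 0 j ^ 2 + M 1 j ^ 2 + M 2 j ^ 2 = (ℓ : ℤ) ^ 2 := by
  have := congrFun (congrFun hM j) j
  simp only [Matrix.mul_apply, Fin.sum_univ_three, Matrix.transpose_apply, Matrix.smul_apply,
    Matrix.one_apply_eq, smul_eq_mul, mul_one] at this
  linear_combination this

lemma abs_apply_le {ℓ : ℕ} {M : Matrix (Fin 3) (Fin 3) ℤ}
    (hM : M.transpose * M = ((ℓ : ℤ) ^ 2) • (1 : Matrix (Fin 3) (Fin 3) ℤ)) (i j : Fin 3) :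
    M i j ∈ Set.Icc (-(ℓ : ℤ)) ℓ := by
  have h := sum_sq_col hM j
  have : M i j ^ 2 ≤ (ℓ : ℤ) ^ 2 := by
    fin_cases i <;> simp <;> nlinarith [sq_nonneg (M 0 j), sq_nonneg (M 1 j), sq_nonneg (M 2 j)]
  exact Set.mem_Icc.2 (abs_le.1 (abs_le_of_sq_le_sq this (Int.natCast_nonneg _)))

lemma primitiveSimilitudes_finite (ℓ : ℕ) : (primitiveSimilitudes ℓ).Finite := by
  refine Set.Finite.subset (s := {M : Matrix (Fin 3) (Fin 3) ℤ |
    ∀ i, M i ∈ {r : Fin 3 → ℤ | ∀ j, r j ∈ Set.Icc (-(ℓ : ℤ)) ℓ}}) ?_ ?_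
  · exact Set.Finite.pi' fun i => Set.Finite.pi' fun j => Set.finite_Icc _ _
  · intro M hM i j
    exact abs_apply_le hM.1 i j

/-! ### Parity obstruction -/

lemma two_dvd_of_four_dvd_sum_sq {a b c : ℤ} (h : (4 : ℤ) ∣ a ^ 2 + b ^ 2 + c ^ 2) :
    2 ∣ a ∧ 2 ∣ b ∧ 2 ∣ c := by
  have h' : ∀ x y z : ZMod 4, x ^ 2 + y ^ 2 + z ^ 2 = 0 → 2 * x = 0 ∧ 2 * y = 0 ∧ 2 * z = 0 := by
    decide
  have h0 := h' a b c (by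
    have := (ZMod.intCast_zmod_eq_zero_iff_dvd (a ^ 2 + b ^ 2 + c ^ 2) 4).2 (by exact_mod_cast h)
    exact_mod_cast this)
  have conv : ∀ x : ℤ, (2 * x : ZMod 4) = 0 → (2 : ℤ) ∣ x := by
    intro x hx
    have := (ZMod.intCast_zmod_eq_zero_iff_dvd (2 * x) 4).1 (by exact_mod_cast hx)
    omega
  exact ⟨conv a h0.1, conv b h0.2.1, conv c h0.2.2⟩

lemma primitiveSimilitudes_eq_empty_of_even {ℓ : ℕ} (hℓ : Even ℓ) :
    primitiveSimilitudes ℓ = ∅ := by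
  rw [Set.eq_empty_iff_forall_notMem]
  intro M hM
  obtain ⟨i, j, hij⟩ := hM.2 2 Nat.prime_two hℓ.two_dvd
  obtain ⟨k, rfl⟩ := hℓ
  have h := sum_sq_col hM.1 j
  have h4 : (4 : ℤ) ∣ M 0 j ^ 2 + M 1 j ^ 2 + M 2 j ^ 2 := by
    rw [h]; exact ⟨k ^ 2, by push_cast; ring⟩
  obtain ⟨h0, h1, h2⟩ := two_dvd_of_four_dvd_sum_sq h4
  fin_cases i
  · exact hij h0
  · exact hij h1
  · exact hij h2

/-! ### Reduction modulo `ℓ` and its isotropic line -/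

/-- The unimodular isotropic vectors of the quadratic form `x² + y² + z²` over `R`. -/
def isotropicVectors (R : Type*) [CommRing R] : Set (Fin 3 → R) :=
  {v | v ⬝ᵥ v = 0 ∧ ∃ b : Fin 3 → R, b ⬝ᵥ v = 1}

/-- The reduction of an integer matrix modulo `m`. -/
def modMat (m : ℕ) (M : Matrix (Fin 3) (Fin 3) ℤ) : Matrix (Fin 3) (Fin 3) (ZMod m) :=
  M.map (Int.cast : ℤ → ZMod m)

lemma modMat_mul (m : ℕ) (A B : Matrix (Fin 3) (Fin 3) ℤ) :
    modMat m (A * B) = modMat m A * modMat m B :=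
  Matrix.map_mul (f := Int.castRingHom (ZMod m))

lemma modMat_mulVec (m : ℕ) (A : Matrix (Fin 3) (Fin 3) ℤ) (a : Fin 3 → ℤ) :
    modMat m A *ᵥ (fun i => (a i : ZMod m)) = fun i => ((A *ᵥ a) i : ZMod m) := by
  ext i
  simp [modMat, Matrix.mulVec, dotProduct]

lemma exists_intCast_eq {m : ℕ} (a : Fin 3 → ZMod m) :
    ∃ a' : Fin 3 → ℤ, (fun i => (a' i : ZMod m)) = a := by
  choose a' h using fun i => ZMod.intCast_surjective (a i)
  exact ⟨a', funext h⟩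

section Similitude

variable {ℓ : ℕ} {M : Matrix (Fin 3) (Fin 3) ℤ}

lemma mul_transpose_of_transpose_mul (hℓ : ℓ ≠ 0)
    (hM : M.transpose * M = ((ℓ : ℤ) ^ 2) • (1 : Matrix (Fin 3) (Fin 3) ℤ)) :
    M * M.transpose = ((ℓ : ℤ) ^ 2) • (1 : Matrix (Fin 3) (Fin 3) ℤ) := by
  have h := (ratScale_mem_orthogonalGroup_iff hℓ M).2 hM
  have h2 := (ratScale_mem_orthogonalGroup_iff hℓ M.transpose).1 (by
    rw [Matrix.mem_orthogonalGroup_iff']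
    rw [Matrix.mem_orthogonalGroup_iff] at h
    rwa [ratScale, Matrix.transpose_map, ← Matrix.transpose_smul,
      Matrix.transpose_transpose])
  rwa [Matrix.transpose_transpose] at h2

lemma det_sq_eq (hM : M.transpose * M = ((ℓ : ℤ) ^ 2) • (1 : Matrix (Fin 3) (Fin 3) ℤ)) :
    M.det ^ 2 = ((ℓ : ℤ) ^ 3) ^ 2 := by
  have := congrArg Matrix.det hM
  rw [Matrix.det_mul, Matrix.det_transpose, Matrix.det_smul, Matrix.det_one] at this
  rw [pow_two, this]; simp; ring

/-- The inverse of `M` is `Mᵀ / ℓ²` and `det M = ±ℓ³`. -/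
lemma adjugate_eq (hℓ : ℓ ≠ 0)
    (hM : M.transpose * M = ((ℓ : ℤ) ^ 2) • (1 : Matrix (Fin 3) (Fin 3) ℤ)) :
    M.adjugate = (ℓ : ℤ) • M.transpose ∨ M.adjugate = (-(ℓ : ℤ)) • M.transpose := by
  have h1 : ((ℓ : ℤ) ^ 2) • M.adjugate = M.det • M.transpose := by
    calc ((ℓ : ℤ) ^ 2) • M.adjugate = M.adjugate * (M * M.transpose) := by
          rw [mul_transpose_of_transpose_mul hℓ hM, Matrix.mul_smul, mul_one]
      _ = M.det • M.transpose := by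
          rw [← mul_assoc, Matrix.adjugate_mul, Matrix.smul_mul, one_mul]
  have hl : ((ℓ : ℤ) ^ 2) ≠ 0 := pow_ne_zero _ (by exact_mod_cast hℓ)
  rcases sq_eq_sq_iff_eq_or_eq_neg.1 (det_sq_eq hM) with h | h
  · left
    apply smul_right_injective _ hl
    simp only [h1, smul_smul, h]; congr 1
  · right
    apply smul_right_injective _ hl
    simp only [h1, smul_smul, h]; congr 1; ring

/-- Up to sign, the nontrivial minors are the entries of the adjugate, which is `±ℓ Mᵀ`. -/
lemma dvd_minor (hℓ : ℓ ≠ 0)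
    (hM : M.transpose * M = ((ℓ : ℤ) ^ 2) • (1 : Matrix (Fin 3) (Fin 3) ℤ)) (i j k l : Fin 3) :
    (ℓ : ℤ) ∣ M i k * M j l - M i l * M j k := by
  have h : ∀ a b, (ℓ : ℤ) ∣ M.adjugate a b := by
    intro a b
    rcases adjugate_eq hℓ hM with h | h <;> rw [h] <;> simp
  rw [Matrix.adjugate_fin_three] at h
  obtain ⟨c00, h00⟩ := h 0 0
  obtain ⟨c01, h01⟩ := h 0 1
  obtain ⟨c02, h02⟩ := h 0 2
  obtain ⟨c10, h10⟩ := h 1 0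
  obtain ⟨c11, h11⟩ := h 1 1
  obtain ⟨c12, h12⟩ := h 1 2
  obtain ⟨c20, h20⟩ := h 2 0
  obtain ⟨c21, h21⟩ := h 2 1
  obtain ⟨c22, h22⟩ := h 2 2
  simp only [Matrix.of_apply, Matrix.cons_val] at h00 h01 h02 h10 h11 h12 h20 h21 h22
  fin_cases i <;> fin_cases j <;> fin_cases k <;> fin_cases l <;>
    simp only [Fin.zero_eta, Fin.mk_one, Fin.reduceFinMk] <;>
    first
    | exact ⟨0, by ring1⟩
    | exact ⟨c00, by linear_combination h00⟩ | exact ⟨-c00, by linear_combination -h00⟩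
    | exact ⟨c01, by linear_combination h01⟩ | exact ⟨-c01, by linear_combination -h01⟩
    | exact ⟨c02, by linear_combination h02⟩ | exact ⟨-c02, by linear_combination -h02⟩
    | exact ⟨c10, by linear_combination h10⟩ | exact ⟨-c10, by linear_combination -h10⟩
    | exact ⟨c11, by linear_combination h11⟩ | exact ⟨-c11, by linear_combination -h11⟩
    | exact ⟨c12, by linear_combination h12⟩ | exact ⟨-c12, by linear_combination -h12⟩
    | exact ⟨c20, by linear_combination h20⟩ | exact ⟨-c20, by linear_combination -h20⟩
    | exact ⟨c21, by linear_combination h21⟩ | exact ⟨-c21, by linear_combination -h21⟩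
    | exact ⟨c22, by linear_combination h22⟩ | exact ⟨-c22, by linear_combination -h22⟩

lemma modMat_minor (hℓ : ℓ ≠ 0)
    (hM : M.transpose * M = ((ℓ : ℤ) ^ 2) • (1 : Matrix (Fin 3) (Fin 3) ℤ)) (i j k l : Fin 3) :
    modMat ℓ M i k * modMat ℓ M j l = modMat ℓ M i l * modMat ℓ M j k := by
  have h := (ZMod.intCast_zmod_eq_zero_iff_dvd _ ℓ).2 (dvd_minor hℓ hM i j k l)
  push_cast at h
  exact sub_eq_zero.1 h

/-- The reduction of `M` modulo `ℓ` has rank at most one. -/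
lemma modMat_mulVec_mul_comm (hℓ : ℓ ≠ 0)
    (hM : M.transpose * M = ((ℓ : ℤ) ^ 2) • (1 : Matrix (Fin 3) (Fin 3) ℤ))
    (x y : Fin 3 → ZMod ℓ) (i j : Fin 3) :
    (modMat ℓ M *ᵥ x) i * (modMat ℓ M *ᵥ y) j = (modMat ℓ M *ᵥ x) j * (modMat ℓ M *ᵥ y) i := by
  simp only [Matrix.mulVec, dotProduct, Finset.sum_mul_sum]
  refine Finset.sum_congr rfl fun k _ => Finset.sum_congr rfl fun l _ => ?_
  linear_combination (x k * y l) * modMat_minor hℓ hM i j k l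

/-- Multiplying by `b ⬝ᵥ M x = 1` and exchanging indices through the vanishing minors shows that a
unimodular `M x` spans the whole column space. -/
lemma eq_smul_of_unimodular (hℓ : ℓ ≠ 0)
    (hM : M.transpose * M = ((ℓ : ℤ) ^ 2) • (1 : Matrix (Fin 3) (Fin 3) ℤ))
    {x y b : Fin 3 → ZMod ℓ} (hb : b ⬝ᵥ (modMat ℓ M *ᵥ x) = 1) :
    modMat ℓ M *ᵥ y = (b ⬝ᵥ (modMat ℓ M *ᵥ y)) • (modMat ℓ M *ᵥ x) := by
  ext i
  calc (modMat ℓ M *ᵥ y) i = (b ⬝ᵥ (modMat ℓ M *ᵥ x)) * (modMat ℓ M *ᵥ y) i := by rw [hb, one_mul]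
    _ = _ := by
      simp only [dotProduct, Pi.smul_apply, smul_eq_mul, Finset.sum_mul]
      refine Finset.sum_congr rfl fun k _ => ?_
      rw [mul_assoc, modMat_mulVec_mul_comm hℓ hM, mul_assoc]
      ring

lemma dvd_dotProduct_mulVec
    (hM : M.transpose * M = ((ℓ : ℤ) ^ 2) • (1 : Matrix (Fin 3) (Fin 3) ℤ)) (a b : Fin 3 → ℤ) :
    ((M *ᵥ a) ⬝ᵥ (M *ᵥ b)) = (ℓ : ℤ) ^ 2 * (a ⬝ᵥ b) := by
  rw [Matrix.dotProduct_mulVec, ← Matrix.mulVec_transpose, Matrix.mulVec_mulVec, hM,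
    Matrix.smul_mulVec, Matrix.one_mulVec, smul_dotProduct, smul_eq_mul]

/-- An integer vector that is nonzero modulo each prime divisor of `m` is unimodular modulo
`m`. -/
lemma exists_dotProduct_modEq_one {m : ℕ} {v : Fin 3 → ℤ}
    (hv : ∀ p : ℕ, p.Prime → p ∣ m → ∃ i, ¬ (p : ℤ) ∣ v i) :
    ∃ b : Fin 3 → ℤ, (m : ℤ) ∣ b ⬝ᵥ v - 1 := by
  have h : Ideal.span {v 0, v 1, v 2, (m : ℤ)} = ⊤ := by
    obtain ⟨g, hg⟩ := (IsPrincipalIdealRing.principal (Ideal.span {v 0, v 1, v 2, (m : ℤ)})).1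
    have hmem : ∀ x ∈ ({v 0, v 1, v 2, (m : ℤ)} : Set ℤ), g ∣ x := fun x hx =>
      Ideal.mem_span_singleton.1 (by
        have := Ideal.subset_span hx
        rw [hg] at this; exact this)
    rw [hg]
    rw [Ideal.submodule_span_eq, Ideal.span_singleton_eq_top, Int.isUnit_iff_natAbs_eq]
    by_contra hne
    obtain ⟨p, hp, hpg⟩ := Nat.exists_prime_and_dvd hne
    have hpg' : (p : ℤ) ∣ g := Int.natCast_dvd.2 hpg
    obtain ⟨i, hi⟩ := hv p hp (Int.natCast_dvd_natCast.1 (hpg'.trans (hmem _ (by simp))))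
    apply hi
    refine hpg'.trans (hmem _ ?_)
    fin_cases i <;> simp
  have h1 : (1 : ℤ) ∈ Ideal.span {v 0, v 1, v 2, (m : ℤ)} := by rw [h]; trivial
  simp only [Ideal.mem_span_insert, Ideal.mem_span_singleton] at h1
  obtain ⟨a, _, ⟨b, _, ⟨c, _, ⟨d, rfl⟩, rfl⟩, rfl⟩, h1⟩ := h1
  refine ⟨![a, b, c], -d, ?_⟩
  simp only [dotProduct, Fin.sum_univ_three, Matrix.cons_val]
  linear_combination -h1

lemma exists_mulVec_unimodular (hM : M ∈ primitiveSimilitudes ℓ) :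
    ∃ a : Fin 3 → ℤ, ∀ p : ℕ, p.Prime → p ∣ ℓ → ∃ i, ¬ (p : ℤ) ∣ (M *ᵥ a) i := by
  -- For `ℓ = 0` the matrix `M` is zero, which is not primitive at 2.
  by_cases hℓ : ℓ = 0
  · subst hℓ
    have h : M = 0 := by
      ext i j
      have := abs_apply_le hM.1 i j
      simpa using this
    obtain ⟨i, j, hij⟩ := hM.2 2 Nat.prime_two (by simp)
    simp [h] at hij
  have hex : ∀ p : ℕ, ∃ j, p.Prime → p ∣ ℓ → ∃ i, ¬ (p : ℤ) ∣ M i j := by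
    intro p
    by_cases h : p.Prime ∧ p ∣ ℓ
    · obtain ⟨i, j, hij⟩ := hM.2 p h.1 h.2
      exact ⟨j, fun _ _ => ⟨i, hij⟩⟩
    · exact ⟨0, fun h1 h2 => absurd ⟨h1, h2⟩ h⟩
  choose c hc using hex
  -- Column `c p` is nonzero modulo `p`. The coefficients are chosen so that, modulo each `p`, the
  -- combination of columns reduces to column `c p`.
  have crt : ∀ k : Fin 3, ∃ a : ℕ, ∀ p ∈ ℓ.primeFactors,
      a ≡ (if c p = k then 1 else 0) [MOD p] := by
    intro k
    let r := Nat.chineseRemainderOfFinset (fun p => if c p = k then 1 else 0) (fun p => p)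
      ℓ.primeFactors (fun p hp => (Nat.prime_of_mem_primeFactors hp).ne_zero)
      (fun p hp q hq hpq => (Nat.coprime_primes (Nat.prime_of_mem_primeFactors hp)
        (Nat.prime_of_mem_primeFactors hq)).2 hpq)
    exact ⟨r.1, r.2⟩
  choose a ha using crt
  refine ⟨fun k => a k, fun p hp hpl => ?_⟩
  obtain ⟨i, hi⟩ := hc p hp hpl
  refine ⟨i, fun hdvd => hi ?_⟩
  have hmod : ∀ k, ((a k : ℤ) : ZMod p) = if c p = k then 1 else 0 := by
    intro k
    have := (ZMod.natCast_eq_natCast_iff _ _ p).2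
      (ha k p (Nat.mem_primeFactors.2 ⟨hp, hpl, hℓ⟩))
    rw [Int.cast_natCast, this]; split_ifs <;> simp
  rw [← ZMod.intCast_zmod_eq_zero_iff_dvd] at hdvd ⊢
  simp only [Matrix.mulVec, dotProduct] at hdvd
  push_cast [-Int.cast_natCast] at hdvd
  simp only [hmod] at hdvd
  simpa using hdvd

lemma exists_isotropic_mulVec (hM : M ∈ primitiveSimilitudes ℓ) :
    ∃ a : Fin 3 → ZMod ℓ, modMat ℓ M *ᵥ a ∈ isotropicVectors (ZMod ℓ) := by
  obtain ⟨a, ha⟩ := exists_mulVec_unimodular hM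
  obtain ⟨b, hb⟩ := exists_dotProduct_modEq_one ha
  refine ⟨fun i => (a i : ZMod ℓ), ?_, fun i => (b i : ZMod ℓ), ?_⟩
  · rw [modMat_mulVec]
    have := congrArg (Int.cast : ℤ → ZMod ℓ) (dvd_dotProduct_mulVec hM.1 a a)
    simp only [dotProduct] at this ⊢
    push_cast at this
    rw [this]; simp
  · rw [modMat_mulVec]
    have := (ZMod.intCast_zmod_eq_zero_iff_dvd _ ℓ).2 hb
    simp only [dotProduct] at this ⊢
    push_cast at this
    exact sub_eq_zero.1 this

/-- The unimodular vectors on a line with unimodular generator are the unit multiples of that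
generator. -/
lemma ncard_isotropic_mulVec [NeZero ℓ] (hM : M ∈ primitiveSimilitudes ℓ) :
    Set.ncard {v | v ∈ isotropicVectors (ZMod ℓ) ∧ ∃ a, modMat ℓ M *ᵥ a = v} = ℓ.totient := by
  have hℓ : ℓ ≠ 0 := NeZero.ne ℓ
  obtain ⟨a, h0, b, hb⟩ := exists_isotropic_mulVec hM
  have himg : {v | v ∈ isotropicVectors (ZMod ℓ) ∧ ∃ a, modMat ℓ M *ᵥ a = v} =
      Set.range (fun u : (ZMod ℓ)ˣ => (u : ZMod ℓ) • (modMat ℓ M *ᵥ a)) := by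
    ext v
    constructor
    · rintro ⟨⟨_, b', hb'⟩, y, rfl⟩
      have h := eq_smul_of_unimodular hℓ hM.1 (y := y) hb
      have hu : IsUnit (b ⬝ᵥ (modMat ℓ M *ᵥ y)) := by
        refine IsUnit.of_mul_eq_one (b' ⬝ᵥ (modMat ℓ M *ᵥ a)) ?_
        rw [← smul_eq_mul, ← dotProduct_smul, ← h, hb']
      exact ⟨hu.unit, h.symm⟩
    · rintro ⟨u, rfl⟩
      refine ⟨⟨?_, (u⁻¹ : (ZMod ℓ)ˣ).1 • b, ?_⟩, (u : ZMod ℓ) • a, ?_⟩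
      · simp [h0]
      · simp [hb]
      · simp [Matrix.mulVec_smul]
  rw [himg, ← Set.image_univ, Set.ncard_image_of_injective, Set.ncard_univ, Nat.card_eq_fintype_card,
    ZMod.card_units_eq_totient]
  intro u u' huu
  ext
  have := congrArg (fun w => b ⬝ᵥ w) huu
  simpa [hb] using this

end Similitude

/-! ### Signed permutation matrices and similitudes with a given line -/

/-- The six integer vectors of norm one. -/
def unitVectors : Fin 6 → Fin 3 → ℤ :=
  ![![1, 0, 0], ![-1, 0, 0], ![0, 1, 0], ![0, -1, 0], ![0, 0, 1], ![0, 0, -1]]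

lemma unitVectors_injective : Function.Injective unitVectors := by
  unfold Function.Injective unitVectors; decide

lemma exists_unitVectors_eq {w : Fin 3 → ℤ} (hw : w ⬝ᵥ w = 1) : ∃ k, unitVectors k = w := by
  simp only [dotProduct, Fin.sum_univ_three] at hw
  have hb : ∀ i, -1 ≤ w i ∧ w i ≤ 1 := by
    intro i
    apply abs_le.1
    apply abs_le_of_sq_le_sq _ zero_le_one
    fin_cases i <;> simp only [Fin.zero_eta, Fin.mk_one, Fin.reduceFinMk] <;>
      nlinarith [mul_self_nonneg (w 0), mul_self_nonneg (w 1), mul_self_nonneg (w 2)]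
  have hw' : w = ![w 0, w 1, w 2] := by ext i; fin_cases i <;> rfl
  rw [hw']
  obtain ⟨h0, h0'⟩ := hb 0
  obtain ⟨h1, h1'⟩ := hb 1
  obtain ⟨h2, h2'⟩ := hb 2
  generalize w 0 = x at *
  generalize w 1 = y at *
  generalize w 2 = z at *
  interval_cases x <;> interval_cases y <;> interval_cases z <;>
    first | omega | (unfold unitVectors; decide)

/-- The columns are three mutually orthogonal vectors among the six unit vectors: `48 = 2³ · 3!`. -/
lemma ncard_transpose_mul_eq_one :
    Set.ncard {S : Matrix (Fin 3) (Fin 3) ℤ | S.transpose * S = 1} = 48 := by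
  have hS : {S : Matrix (Fin 3) (Fin 3) ℤ | S.transpose * S = 1} =
      (fun t : Fin 3 → Fin 6 => (Matrix.of fun j => unitVectors (t j)).transpose) ''
        ((Finset.univ.filter fun t : Fin 3 → Fin 6 => ∀ a b,
          unitVectors (t a) ⬝ᵥ unitVectors (t b) = if a = b then 1 else 0 : Finset _) :
            Set (Fin 3 → Fin 6)) := by
    ext S
    simp only [Set.mem_ofPred_eq, Set.mem_image, Finset.coe_filter, Finset.mem_univ, true_and]
    constructor
    · intro h
      have hd : ∀ a b, S.transpose a ⬝ᵥ S.transpose b = if a = b then 1 else 0 := by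
        intro a b
        have := congrFun (congrFun h a) b
        rw [Matrix.one_apply] at this
        exact this
      choose t ht using fun j => exists_unitVectors_eq (w := S.transpose j) (by simpa using hd j j)
      refine ⟨t, fun a b => by rw [ht, ht, hd], ?_⟩
      ext i j
      simp [ht]
    · rintro ⟨t, ht, rfl⟩
      ext a b
      rw [Matrix.one_apply, ← ht a b]
      rfl
  rw [hS, Set.ncard_image_of_injective, Set.ncard_coe_finset]
  · unfold unitVectors
    decide +kernel
  · intro t t' h
    funext j
    apply unitVectors_injective
    ext i
    exact congrFun (congrFun h i) j

section Similitude

variable {ℓ : ℕ} {M N : Matrix (Fin 3) (Fin 3) ℤ}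

/-- The splitting comes from the rank one reduction. The divisibility of `M a ⬝ᵥ s` is the
second-order information: `M a ⬝ᵥ M y` and `M a ⬝ᵥ M a` are both divisible by `ℓ²`, so `ℓ (M a ⬝ᵥ
s)` is too. -/
lemma exists_mulVec_eq_smul_add (hℓ : ℓ ≠ 0)
    (hM : M.transpose * M = ((ℓ : ℤ) ^ 2) • (1 : Matrix (Fin 3) (Fin 3) ℤ))
    {a : Fin 3 → ℤ} {b : Fin 3 → ZMod ℓ}
    (hb : b ⬝ᵥ (fun i => ((M *ᵥ a) i : ZMod ℓ)) = 1) (y : Fin 3 → ℤ) :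
    ∃ (w : ℤ) (s : Fin 3 → ℤ), M *ᵥ y = w • (M *ᵥ a) + (ℓ : ℤ) • s ∧
      (ℓ : ℤ) ∣ (M *ᵥ a) ⬝ᵥ s := by
  have h := eq_smul_of_unimodular hℓ hM (x := fun i => (a i : ZMod ℓ))
    (y := fun i => (y i : ZMod ℓ)) (b := b) (by rwa [modMat_mulVec])
  obtain ⟨w, hw⟩ := ZMod.intCast_surjective (b ⬝ᵥ (modMat ℓ M *ᵥ fun i => (y i : ZMod ℓ)))
  rw [← hw, modMat_mulVec, modMat_mulVec] at h
  have hd : ∀ i, (ℓ : ℤ) ∣ (M *ᵥ y) i - w * (M *ᵥ a) i := by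
    intro i
    rw [← ZMod.intCast_zmod_eq_zero_iff_dvd]
    have := congrFun h i
    simp only [Pi.smul_apply, smul_eq_mul] at this
    push_cast
    rw [this, sub_self]
  choose s hs using hd
  have hys : M *ᵥ y = w • (M *ᵥ a) + (ℓ : ℤ) • s := by
    ext i
    simp only [Pi.add_apply, Pi.smul_apply, smul_eq_mul]
    linear_combination hs i
  refine ⟨w, s, hys, a ⬝ᵥ y - w * (a ⬝ᵥ a), ?_⟩
  have h1 := dvd_dotProduct_mulVec hM a y
  have h2 := dvd_dotProduct_mulVec hM a a
  rw [hys, dotProduct_add, dotProduct_smul, dotProduct_smul, smul_eq_mul, smul_eq_mul, h2] at h1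
  apply mul_left_cancel₀ (show (ℓ : ℤ) ≠ 0 by exact_mod_cast hℓ)
  linear_combination h1

lemma exists_eq_add_smul_of_intCast_eq {v w : Fin 3 → ℤ}
    (h : (fun i => (v i : ZMod ℓ)) = fun i => (w i : ZMod ℓ)) :
    ∃ u : Fin 3 → ℤ, w = v + (ℓ : ℤ) • u := by
  have hd : ∀ i, (ℓ : ℤ) ∣ w i - v i := by
    intro i
    rw [← ZMod.intCast_zmod_eq_zero_iff_dvd]
    have := congrFun h i
    push_cast
    rw [this, sub_self]
  choose u hu using hd
  exact ⟨u, by ext i; simp only [Pi.add_apply, Pi.smul_apply, smul_eq_mul]; linear_combination hu i⟩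

/-- If the reductions modulo `ℓ` of two similitudes share a unimodular vector in their column
spaces, then the two similitudes differ by an integral orthogonal matrix. -/
lemma exists_eq_mul_of_mulVec_eq (hodd : Odd ℓ)
    (hM : M.transpose * M = ((ℓ : ℤ) ^ 2) • (1 : Matrix (Fin 3) (Fin 3) ℤ))
    (hN : N.transpose * N = ((ℓ : ℤ) ^ 2) • (1 : Matrix (Fin 3) (Fin 3) ℤ))
    {v x y : Fin 3 → ZMod ℓ} (hv : ∃ b, b ⬝ᵥ v = 1)
    (hx : modMat ℓ M *ᵥ x = v) (hy : modMat ℓ N *ᵥ y = v) :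
    ∃ S : Matrix (Fin 3) (Fin 3) ℤ, S.transpose * S = 1 ∧ N = M * S := by
  have hℓ : ℓ ≠ 0 := hodd.pos.ne'
  have hl : (ℓ : ℤ) ≠ 0 := by exact_mod_cast hℓ
  obtain ⟨b, hb⟩ := hv
  obtain ⟨a, rfl⟩ := exists_intCast_eq x
  obtain ⟨c, rfl⟩ := exists_intCast_eq y
  rw [modMat_mulVec] at hx hy
  obtain ⟨u, hu⟩ := exists_eq_add_smul_of_intCast_eq (hx.trans hy.symm)
  have ha := dvd_dotProduct_mulVec hM a a
  have hc := dvd_dotProduct_mulVec hN c c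
  -- Expanding the norm of `N c = M a + ℓ u` modulo `ℓ²` leaves `2 ℓ (M a ⬝ᵥ u) ≡ 0`; this is where
  -- oddness of `ℓ` enters.
  have hdu : (ℓ : ℤ) ∣ (M *ᵥ a) ⬝ᵥ u := by
    have h2 : IsCoprime (ℓ : ℤ) 2 := by
      exact_mod_cast (Nat.isCoprime_iff_coprime (m := ℓ) (n := 2)).2 hodd.coprime_two_right
    refine h2.dvd_of_dvd_mul_left ⟨c ⬝ᵥ c - a ⬝ᵥ a - u ⬝ᵥ u, ?_⟩
    rw [hu, dotProduct_add, add_dotProduct, add_dotProduct] at hc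
    simp only [dotProduct_smul, smul_dotProduct, smul_eq_mul] at hc
    rw [dotProduct_comm u (M *ᵥ a), ha] at hc
    apply mul_left_cancel₀ hl
    linear_combination hc
  -- Both images lie in the span of `M a` plus `ℓ` times vectors orthogonal to it modulo `ℓ`, so all
  -- cross terms are divisible by `ℓ²`. Thus `MᵀN / ℓ²` is integral, and it is the required `S`.
  have hdvd : ∀ y z : Fin 3 → ℤ, ((ℓ : ℤ) ^ 2) ∣ (M *ᵥ y) ⬝ᵥ (N *ᵥ z) := by
    intro y z
    obtain ⟨w, s, hs, k, hk⟩ := exists_mulVec_eq_smul_add hℓ hM (hx ▸ hb) y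
    obtain ⟨w', s', hs', k', hk'⟩ := exists_mulVec_eq_smul_add hℓ hN (hy ▸ hb) z
    obtain ⟨m, hm⟩ := hdu
    rw [hs, hs', hu]
    rw [hu] at hk'
    simp only [dotProduct_add, add_dotProduct, dotProduct_smul, smul_dotProduct, smul_eq_mul]
      at hk' ⊢
    rw [dotProduct_comm s (M *ᵥ a), ha, hk, hm]
    refine ⟨w * w' * (a ⬝ᵥ a) + w * w' * m + w * (k' - u ⬝ᵥ s') + w' * k +
      w' * (s ⬝ᵥ u) + s ⬝ᵥ s', ?_⟩
    linear_combination (ℓ : ℤ) * w * hk'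
  have hent : ∀ i j, ((ℓ : ℤ) ^ 2) ∣ (M.transpose * N) i j := by
    intro i j
    have := hdvd (Pi.single i 1) (Pi.single j 1)
    rw [Matrix.mulVec_single_one, Matrix.mulVec_single_one] at this
    exact this
  choose S hS using hent
  have hMN : M.transpose * N = ((ℓ : ℤ) ^ 2) • Matrix.of S := by
    ext i j; simp [hS]
  have hl2 : ((ℓ : ℤ) ^ 2) ≠ 0 := pow_ne_zero _ hl
  have hNS : N = M * Matrix.of S := by
    apply smul_right_injective _ hl2
    simp only
    rw [← Matrix.mul_smul, ← hMN, ← mul_assoc, mul_transpose_of_transpose_mul hℓ hM,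
      Matrix.smul_mul, one_mul]
  refine ⟨Matrix.of S, ?_, hNS⟩
  apply smul_right_injective _ hl2
  simp only
  rw [← hN]
  conv_rhs => rw [hNS]
  rw [Matrix.transpose_mul, mul_assoc, ← mul_assoc M.transpose, hM, Matrix.smul_mul, one_mul,
    Matrix.mul_smul]

lemma mul_mem_primitiveSimilitudes {S : Matrix (Fin 3) (Fin 3) ℤ} (hS : S.transpose * S = 1)
    (hM : M ∈ primitiveSimilitudes ℓ) : M * S ∈ primitiveSimilitudes ℓ := by
  have hS' : S * S.transpose = 1 := mul_eq_one_comm.1 hS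
  refine ⟨?_, fun p hp hpl => ?_⟩
  · rw [Matrix.transpose_mul, mul_assoc, ← mul_assoc M.transpose, hM.1, Matrix.smul_mul, one_mul,
      Matrix.mul_smul, hS]
  · by_contra! h
    obtain ⟨i, j, hij⟩ := hM.2 p hp hpl
    apply hij
    have hM' : M = M * S * S.transpose := by rw [mul_assoc, hS', mul_one]
    rw [hM', Matrix.mul_apply]
    exact Finset.dvd_sum fun k _ => (h i k).mul_right _

lemma ncard_mulVec_eq (hodd : Odd ℓ) {v : Fin 3 → ZMod ℓ} (hv : ∃ b, b ⬝ᵥ v = 1)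
    (hex : ∃ M ∈ primitiveSimilitudes ℓ, ∃ a, modMat ℓ M *ᵥ a = v) :
    Set.ncard {M | M ∈ primitiveSimilitudes ℓ ∧ ∃ a, modMat ℓ M *ᵥ a = v} = 48 := by
  obtain ⟨M, hM, a, ha⟩ := hex
  have hℓ : ℓ ≠ 0 := hodd.pos.ne'
  have himg : {N | N ∈ primitiveSimilitudes ℓ ∧ ∃ a, modMat ℓ N *ᵥ a = v} =
      (fun S => M * S) '' {S : Matrix (Fin 3) (Fin 3) ℤ | S.transpose * S = 1} := by
    ext N
    constructor
    · rintro ⟨hN, y, hy⟩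
      obtain ⟨S, hS, hNS⟩ := exists_eq_mul_of_mulVec_eq hodd hM.1 hN.1 hv ha hy
      exact ⟨S, hS, hNS.symm⟩
    · rintro ⟨S, hS, rfl⟩
      refine ⟨mul_mem_primitiveSimilitudes hS hM, modMat ℓ S.transpose *ᵥ a, ?_⟩
      rw [Matrix.mulVec_mulVec, ← modMat_mul, mul_assoc, mul_eq_one_comm.1 hS, mul_one, ha]
  rw [himg, Set.ncard_image_of_injective, ncard_transpose_mul_eq_one]
  intro S T h
  have hl2 : ((ℓ : ℤ) ^ 2) ≠ 0 := pow_ne_zero _ (by exact_mod_cast hℓ)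
  apply smul_right_injective _ hl2
  have := congrArg (fun A => M.transpose * A) h
  simp only [← mul_assoc, hM.1, Matrix.smul_mul, one_mul] at this
  exact this

end Similitude

/-! ### Counting isotropic vectors -/

lemma map_mem_isotropicVectors {R S : Type*} [CommRing R] [CommRing S] (f : R →+* S)
    {v : Fin 3 → R} (hv : v ∈ isotropicVectors R) : (fun i => f (v i)) ∈ isotropicVectors S := by
  obtain ⟨h, b, hb⟩ := hv
  refine ⟨?_, fun i => f (b i), ?_⟩
  · have := congrArg f h
    simpa [dotProduct] using this
  · have := congrArg f hb
    simpa [dotProduct] using this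

lemma card_isotropicVectors_congr {R S : Type*} [CommRing R] [CommRing S] (e : R ≃+* S) :
    Nat.card (isotropicVectors R) = Nat.card (isotropicVectors S) :=
  Nat.card_congr
    { toFun := fun v => ⟨fun i => e (v.1 i), map_mem_isotropicVectors (e : R →+* S) v.2⟩
      invFun := fun v => ⟨fun i => e.symm (v.1 i),
        map_mem_isotropicVectors (e.symm : S →+* R) v.2⟩
      left_inv := fun v => by simp
      right_inv := fun v => by simp }

lemma card_isotropicVectors_prod (R S : Type*) [CommRing R] [CommRing S] :
    Nat.card (isotropicVectors (R × S)) =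
      Nat.card (isotropicVectors R) * Nat.card (isotropicVectors S) := by
  rw [← Nat.card_prod]
  have hdot : ∀ v w : Fin 3 → R × S, v ⬝ᵥ w =
      ((fun i => (v i).1) ⬝ᵥ (fun i => (w i).1), (fun i => (v i).2) ⬝ᵥ (fun i => (w i).2)) := by
    intro v w
    exact Prod.ext (by simp [dotProduct, Fin.sum_univ_three])
      (by simp [dotProduct, Fin.sum_univ_three])
  refine Nat.card_congr
    { toFun := fun v => (⟨fun i => (v.1 i).1, ?_⟩, ⟨fun i => (v.1 i).2, ?_⟩)
      invFun := fun v => ⟨fun i => (v.1.1 i, v.2.1 i), ?_⟩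
      left_inv := fun v => rfl
      right_inv := fun v => rfl }
  · obtain ⟨v, h, b, hb⟩ := v
    rw [hdot] at h hb
    exact ⟨congrArg Prod.fst h, fun i => (b i).1, congrArg Prod.fst hb⟩
  · obtain ⟨v, h, b, hb⟩ := v
    rw [hdot] at h hb
    exact ⟨congrArg Prod.snd h, fun i => (b i).2, congrArg Prod.snd hb⟩
  · obtain ⟨⟨v, h, b, hb⟩, ⟨w, h', b', hb'⟩⟩ := v
    refine ⟨?_, fun i => (b i, b' i), ?_⟩
    · rw [hdot]; exact Prod.ext h h'
    · rw [hdot]; exact Prod.ext hb hb'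

section LocalRing

variable {R : Type*} [CommRing R]

/-- Coordinates in which `x² + y² + z²` becomes `-(w² + 4 x z)`. -/
def hyperbolicCoords (α β x z w : R) : Fin 3 → R :=
  ![x - z, α * (x + z) - β * w, β * (x + z) + α * w]

lemma hyperbolicCoords_dotProduct {α β : R} (h : α ^ 2 + β ^ 2 = -1) (x z w : R) :
    hyperbolicCoords α β x z w ⬝ᵥ hyperbolicCoords α β x z w = -(w ^ 2 + 4 * x * z) := by
  simp only [hyperbolicCoords, dotProduct, Fin.sum_univ_three, Matrix.cons_val]
  linear_combination ((x + z) ^ 2 + w ^ 2) * h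

lemma dotProduct_hyperbolicCoords_left {α β : R} (h : α ^ 2 + β ^ 2 = -1) (x z w : R) :
    ![1, -α, -β] ⬝ᵥ hyperbolicCoords α β x z w = 2 * x := by
  simp only [hyperbolicCoords, dotProduct, Fin.sum_univ_three, Matrix.cons_val]
  linear_combination -(x + z) * h

lemma dotProduct_hyperbolicCoords_right {α β : R} (h : α ^ 2 + β ^ 2 = -1) (x z w : R) :
    ![-1, -α, -β] ⬝ᵥ hyperbolicCoords α β x z w = 2 * z := by
  simp only [hyperbolicCoords, dotProduct, Fin.sum_univ_three, Matrix.cons_val]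
  linear_combination -(x + z) * h

lemma dotProduct_hyperbolicCoords_mid {α β : R} (h : α ^ 2 + β ^ 2 = -1) (x z w : R) :
    ![0, β, -α] ⬝ᵥ hyperbolicCoords α β x z w = w := by
  simp only [hyperbolicCoords, dotProduct, Fin.sum_univ_three, Matrix.cons_val]
  linear_combination -w * h

lemma hyperbolicCoords_inj (h2 : IsUnit (2 : R)) {α β : R} (h : α ^ 2 + β ^ 2 = -1)
    {x z w x' z' w' : R} (he : hyperbolicCoords α β x z w = hyperbolicCoords α β x' z' w') :
    x = x' ∧ z = z' ∧ w = w' := by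
  refine ⟨h2.mul_left_cancel ?_, h2.mul_left_cancel ?_, ?_⟩
  · rw [← dotProduct_hyperbolicCoords_left h x z w, he, dotProduct_hyperbolicCoords_left h]
  · rw [← dotProduct_hyperbolicCoords_right h x z w, he, dotProduct_hyperbolicCoords_right h]
  · rw [← dotProduct_hyperbolicCoords_mid h x z w, he, dotProduct_hyperbolicCoords_mid h]

lemma exists_hyperbolicCoords_eq (h2 : IsUnit (2 : R)) {α β : R} (h : α ^ 2 + β ^ 2 = -1)
    (v : Fin 3 → R) : ∃ x z w, hyperbolicCoords α β x z w = v := by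
  obtain ⟨t, ht⟩ := h2.exists_right_inv
  refine ⟨t * (v 0 - α * v 1 - β * v 2), t * (-v 0 - α * v 1 - β * v 2), β * v 1 - α * v 2, ?_⟩
  ext i
  fin_cases i <;> simp only [hyperbolicCoords, Fin.zero_eta, Fin.mk_one, Fin.reduceFinMk,
    Matrix.cons_val]
  · linear_combination v 0 * ht
  · linear_combination -α * (α * v 1 + β * v 2) * ht - v 1 * h
  · linear_combination -β * (α * v 1 + β * v 2) * ht - v 2 * h

/-- The equation is `w² = -4xz`. If `x` is a unit, `w` is free and `z` is determined. Otherwise `w`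
is a nonunit, so unimodularity forces `z` to be a unit, and `x` is determined by `z` and the nonunit
`w`. The two cases give the two summands. -/
lemma card_isotropicVectors_of_isLocalRing [IsLocalRing R] [Finite R] (h2 : IsUnit (2 : R))
    {α β : R} (h : α ^ 2 + β ^ 2 = -1) :
    Nat.card (isotropicVectors R) =
      Nat.card Rˣ * (Nat.card R + Nat.card {x : R // ¬ IsUnit x}) := by
  -- `q` is the inverse of 4.
  obtain ⟨q, hq⟩ := (h2.pow 2).exists_right_inv
  rw [mul_add, ← Nat.card_prod, ← Nat.card_prod, ← Nat.card_sum]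
  symm
  have mem : ∀ (u : Rˣ) (w : R),
      hyperbolicCoords α β u (-(w ^ 2 * q * u⁻¹.1)) w ∈ isotropicVectors R := by
    intro u w
    refine ⟨?_, (u⁻¹.1 * (2 * q)) • ![1, -α, -β], ?_⟩
    · rw [hyperbolicCoords_dotProduct h]
      linear_combination w ^ 2 * hq + (w ^ 2 * q * 4) * u.mul_inv
    · rw [smul_dotProduct, dotProduct_hyperbolicCoords_left h, smul_eq_mul]
      linear_combination hq + (2 * 2 * q) * u.mul_inv
  have mem' : ∀ (u : Rˣ) (w : R),
      hyperbolicCoords α β (-(w ^ 2 * q * u⁻¹.1)) u w ∈ isotropicVectors R := by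
    intro u w
    refine ⟨?_, (u⁻¹.1 * (2 * q)) • ![-1, -α, -β], ?_⟩
    · rw [hyperbolicCoords_dotProduct h]
      linear_combination w ^ 2 * hq + (w ^ 2 * q * 4) * u.mul_inv
    · rw [smul_dotProduct, dotProduct_hyperbolicCoords_right h, smul_eq_mul]
      linear_combination hq + (2 * 2 * q) * u.mul_inv
  have solve : ∀ (u : Rˣ) (z w : R), w ^ 2 + 4 * u * z = 0 → z = -(w ^ 2 * q * u⁻¹.1) := by
    intro u z w hz
    linear_combination (-z * u * u⁻¹.1) * hq - z * u.mul_inv + q * u⁻¹.1 * hz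
  refine Nat.card_congr (Equiv.ofBijective (fun s => match s with
    | .inl (u, w) => ⟨hyperbolicCoords α β u (-(w ^ 2 * q * u⁻¹.1)) w, mem u w⟩
    | .inr (u, w) => ⟨hyperbolicCoords α β (-(w.1 ^ 2 * q * u⁻¹.1)) u w.1, mem' u w.1⟩) ⟨?_, ?_⟩)
  · rintro (⟨u, w⟩ | ⟨u, w⟩) (⟨u', w'⟩ | ⟨u', w'⟩) he <;>
      obtain ⟨h1, h3, h4⟩ := hyperbolicCoords_inj h2 h (congrArg Subtype.val he)
    · rw [Units.ext h1, h4]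
    · exfalso
      apply w'.2
      have hu : IsUnit (-(w'.1 ^ 2 * q * u'⁻¹.1)) := h1 ▸ u.isUnit
      rw [IsUnit.neg_iff, mul_assoc] at hu
      exact (isUnit_pow_iff two_ne_zero).1 (isUnit_of_mul_isUnit_left hu)
    · exfalso
      apply w.2
      have hu : IsUnit (-(w.1 ^ 2 * q * u⁻¹.1)) := h1.symm ▸ u'.isUnit
      rw [IsUnit.neg_iff, mul_assoc] at hu
      exact (isUnit_pow_iff two_ne_zero).1 (isUnit_of_mul_isUnit_left hu)
    · rw [Units.ext h3, Subtype.ext h4]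
  · rintro ⟨v, h0, b, hb⟩
    obtain ⟨x, z, w, rfl⟩ := exists_hyperbolicCoords_eq h2 h v
    rw [hyperbolicCoords_dotProduct h, neg_eq_zero] at h0
    by_cases hx : IsUnit x
    · obtain ⟨u, rfl⟩ := hx
      refine ⟨.inl (u, w), Subtype.ext ?_⟩
      simp only
      rw [← solve u z w h0]
    · have hw : ¬ IsUnit w := by
        intro hw
        apply hx
        have : IsUnit (x * (-(4 * z))) := by
          have e : x * (-(4 * z)) = w ^ 2 := by linear_combination -h0
          rw [e]; exact hw.pow 2
        exact isUnit_of_mul_isUnit_left this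
      by_cases hz : IsUnit z
      · obtain ⟨u, rfl⟩ := hz
        refine ⟨.inr (u, ⟨w, hw⟩), Subtype.ext ?_⟩
        simp only
        rw [← solve u x w (by linear_combination h0)]
      · exfalso
        have hx' : x ∈ IsLocalRing.maximalIdeal R := hx
        have hz' : z ∈ IsLocalRing.maximalIdeal R := hz
        have hw' : w ∈ IsLocalRing.maximalIdeal R := hw
        have h1 : (1 : R) ∈ IsLocalRing.maximalIdeal R := by
          rw [← hb]
          simp only [hyperbolicCoords, dotProduct, Fin.sum_univ_three, Matrix.cons_val]
          refine Ideal.add_mem _ (Ideal.add_mem _ ?_ ?_) ?_ <;> refine Ideal.mul_mem_left _ _ ?_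
          · exact Ideal.sub_mem _ hx' hz'
          · exact Ideal.sub_mem _ (Ideal.mul_mem_left _ _ (Ideal.add_mem _ hx' hz'))
              (Ideal.mul_mem_left _ _ hw')
          · exact Ideal.add_mem _ (Ideal.mul_mem_left _ _ (Ideal.add_mem _ hx' hz'))
              (Ideal.mul_mem_left _ _ hw')
        exact (Ideal.ne_top_iff_one _).1 (IsLocalRing.maximalIdeal.isMaximal R).ne_top h1

end LocalRing

/-- `-1` is a sum of two squares in `ℤ_[p]` for `p` odd. -/
lemma PadicInt.exists_sq_add_sq_eq_neg_one (p : ℕ) [hp : Fact p.Prime] (h2 : p ≠ 2) :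
    ∃ α β : ℤ_[p], α ^ 2 + β ^ 2 = -1 := by
  -- `a` and `b` are not both divisible by `p`, so they can be ordered with `a` prime to `p`; then
  -- `2a`, the derivative of `X² + b² + 1` at `a`, is a unit and Hensel's lemma applies.
  obtain ⟨a, b, hab, ha⟩ : ∃ a b : ℕ, p ∣ a ^ 2 + b ^ 2 + 1 ∧ ¬ p ∣ a := by
    obtain ⟨a, b, k, -, -, h⟩ := Int.exists_sq_add_sq_add_one_eq_mul p
    by_cases ha : p ∣ a
    · refine ⟨b, a, ⟨k, by linarith⟩, fun hb => hp.1.one_lt.ne' (Nat.dvd_one.1 ?_)⟩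
      have h3 : p ∣ a ^ 2 + b ^ 2 := dvd_add (dvd_pow ha two_ne_zero) (dvd_pow hb two_ne_zero)
      exact (Nat.dvd_add_right h3).1 (h ▸ dvd_mul_left _ _)
    · exact ⟨a, b, ⟨k, by linarith⟩, ha⟩
  obtain ⟨c, hc⟩ : ∃ c : ℤ_[p], c = (b : ℤ_[p]) ^ 2 + 1 := ⟨_, rfl⟩
  let F : Polynomial ℤ_[p] := Polynomial.X ^ 2 + Polynomial.C c
  have hn : ‖F.derivative.aeval (a : ℤ_[p])‖ = 1 := by
    have e : F.derivative.aeval (a : ℤ_[p]) = ((2 * a : ℤ) : ℤ_[p]) := by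
      simp [F, one_add_one_eq_two]
    rw [e]
    refine le_antisymm (PadicInt.norm_le_one _) (not_lt.1 fun hlt => ?_)
    rw [PadicInt.norm_int_lt_one_iff_dvd] at hlt
    have h3 : p ∣ 2 * a := by exact_mod_cast hlt
    rcases hp.1.dvd_mul.1 h3 with h4 | h4
    · exact h2 ((Nat.prime_dvd_prime_iff_eq hp.1 Nat.prime_two).1 h4)
    · exact ha h4
  obtain ⟨α, hα, -⟩ := hensels_lemma (F := F) (a := (a : ℤ_[p])) (by
    rw [hn]
    have e : F.aeval (a : ℤ_[p]) = (((a ^ 2 + b ^ 2 + 1 : ℕ) : ℤ) : ℤ_[p]) := by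
      simp [F, hc]; ring
    rw [e, one_pow, PadicInt.norm_int_lt_one_iff_dvd]
    exact_mod_cast hab)
  refine ⟨α, b, ?_⟩
  simp only [F, map_add, map_pow, Polynomial.aeval_X, Polynomial.aeval_C, Algebra.algebraMap_self,
    RingHom.id_apply, hc] at hα
  linear_combination hα

lemma card_isotropicVectors_prime_pow {p k : ℕ} (hp : p.Prime) (hk : 0 < k) (h2 : p ≠ 2) :
    Nat.card (isotropicVectors (ZMod (p ^ k))) =
      (p ^ k).totient * (p ^ k + (p ^ k - (p ^ k).totient)) := by
  have : Fact p.Prime := ⟨hp⟩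
  have hlt : 1 < p ^ k := Nat.one_lt_pow hk.ne' hp.one_lt
  have : Fact (1 < p ^ k) := ⟨hlt⟩
  have : NeZero (p ^ k) := ⟨by omega⟩
  have : IsLocalRing (ZMod (p ^ k)) :=
    IsLocalRing.of_surjective' (PadicInt.toZModPow (p := p) k)
      (ZMod.ringHom_surjective _)
  obtain ⟨α, β, h⟩ := PadicInt.exists_sq_add_sq_eq_neg_one p h2
  have hu : IsUnit (2 : ZMod (p ^ k)) := by
    have := (ZMod.isUnit_iff_coprime 2 (p ^ k)).2
      (Nat.Coprime.pow_right k ((Nat.coprime_primes Nat.prime_two hp).2 h2.symm))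
    exact_mod_cast this
  rw [card_isotropicVectors_of_isLocalRing hu (α := PadicInt.toZModPow k α)
    (β := PadicInt.toZModPow k β) (by rw [← map_pow, ← map_pow, ← map_add, h]; simp)]
  have hunits : Nat.card (ZMod (p ^ k))ˣ = (p ^ k).totient := by
    rw [Nat.card_eq_fintype_card, ZMod.card_units_eq_totient]
  have hunits' : Nat.card {x : ZMod (p ^ k) // IsUnit x} = (p ^ k).totient := by
    rw [← hunits]
    exact Nat.card_congr
      { toFun := fun x => x.2.unit
        invFun := fun u => ⟨u, u.isUnit⟩
        left_inv := fun x => Subtype.ext x.2.unit_spec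
        right_inv := fun u => Units.ext u.isUnit.unit_spec }
  have hsum : Nat.card {x : ZMod (p ^ k) // IsUnit x} + Nat.card {x : ZMod (p ^ k) // ¬ IsUnit x} =
      p ^ k := by
    classical
    rw [← Nat.card_sum, Nat.card_congr (Equiv.sumCompl _), Nat.card_zmod]
  rw [hunits, Nat.card_zmod, ← hunits']
  congr 2
  omega

lemma card_isotropicVectors_eq {ℓ : ℕ} (hodd : Odd ℓ) :
    (Nat.card (isotropicVectors (ZMod ℓ)) : ℝ) =
      ℓ.totient * (ℓ * ∏ p ∈ ℓ.primeFactors, (1 + 1 / (p : ℝ))) := by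
  induction ℓ using Nat.recOnPosPrimePosCoprime with
  | prime_pow p k hp hk =>
    have h2 : p ≠ 2 := by
      rintro rfl
      exact (Nat.not_odd_iff_even.2 (even_two.pow_of_ne_zero hk.ne')) hodd
    rw [card_isotropicVectors_prime_pow hp hk h2, Nat.primeFactors_prime_pow hk.ne' hp,
      Finset.prod_singleton]
    push_cast [Nat.cast_sub (Nat.totient_le _)]
    have ht : ((p ^ k).totient : ℝ) = (p : ℝ) ^ k * (1 - 1 / p) := by
      rw [Nat.totient_prime_pow hp hk, Nat.cast_mul, Nat.cast_sub hp.one_lt.le]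
      obtain ⟨m, rfl⟩ := Nat.exists_eq_succ_of_ne_zero hk.ne'
      have : (p : ℝ) ≠ 0 := by exact_mod_cast hp.ne_zero
      push_cast
      simp only [Nat.succ_eq_add_one]
      field_simp
      ring
    congr 1
    rw [ht]; ring
  | zero => simp at hodd
  | one =>
    have : Nat.card (isotropicVectors (ZMod 1)) = 1 := by
      have : isotropicVectors (ZMod 1) = Set.univ := by
        ext v
        simp only [Set.mem_univ, iff_true]
        exact ⟨Subsingleton.elim _ _, 0, Subsingleton.elim _ _⟩
      rw [this, Nat.card_eq_one_iff_unique]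
      exact ⟨inferInstance, ⟨⟨0, trivial⟩⟩⟩
    rw [this]; simp
  | coprime a b ha hb hab iha ihb =>
    rw [Nat.odd_mul] at hodd
    rw [card_isotropicVectors_congr (ZMod.chineseRemainder hab), card_isotropicVectors_prod,
      Nat.cast_mul, iha hodd.1, ihb hodd.2, hab.primeFactors_mul,
      Finset.prod_union hab.disjoint_primeFactors, Nat.totient_mul hab]
    push_cast
    ring

/-! ### Unimodular lattices of rank three and existence of similitudes -/

/-- Minkowski's theorem for the ellipsoid `‖A x‖² < 2` in dimension three. -/
lemma exists_int_dotProduct_mulVec_lt_two (A : Matrix (Fin 3) (Fin 3) ℝ) (h0 : A.det ≠ 0)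
    (h2 : |A.det| ≤ √2) :
    ∃ z : Fin 3 → ℤ, z ≠ 0 ∧
      (A *ᵥ (fun i => (z i : ℝ))) ⬝ᵥ (A *ᵥ (fun i => (z i : ℝ))) < 2 := by
  let b := Pi.basisFun ℝ (Fin 3)
  let L : AddSubgroup (Fin 3 → ℝ) := (Submodule.span ℤ (Set.range b)).toAddSubgroup
  let B : Set (Fin 3 → ℝ) := (WithLp.toLp 2) ⁻¹' Metric.ball (0 : EuclideanSpace ℝ (Fin 3)) √2
  have hB : ∀ y, y ∈ B ↔ y ⬝ᵥ y < 2 := by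
    intro y
    simp only [B, Set.mem_preimage, mem_ball_zero_iff, EuclideanSpace.norm_eq, dotProduct]
    rw [Real.sqrt_lt_sqrt_iff (by positivity)]
    simp [pow_two]
  have hBvol : volume B = ENNReal.ofReal √2 ^ 3 * ENNReal.ofReal (Real.pi * 4 / 3) := by
    rw [(PiLp.volume_preserving_toLp (Fin 3)).measure_preimage
      Metric.isOpen_ball.measurableSet.nullMeasurableSet, EuclideanSpace.volume_ball_fin_three]
  have hBconv : Convex ℝ B :=
    (convex_ball (0 : EuclideanSpace ℝ (Fin 3)) √2).linear_preimage
      (WithLp.linearEquiv 2 ℝ (Fin 3 → ℝ)).symm.toLinearMap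
  have hdet : LinearMap.det (Matrix.toLin' A) ≠ 0 := by rwa [LinearMap.det_toLin']
  have hfund := ZSpan.isAddFundamentalDomain' b (volume : Measure (Fin 3 → ℝ))
  have : Countable L := inferInstanceAs (Countable (Submodule.span ℤ (Set.range b)))
  -- The ellipsoid has volume `2√2 · (4π/3) / |det A|`, which is at least `8π/3 > 2³`.
  obtain ⟨x, hx0, hx⟩ := exists_ne_zero_mem_lattice_of_measure_mul_two_pow_lt_measure
    (s := Matrix.toLin' A ⁻¹' B) hfund
    (fun x hx => by
      simp only [Set.mem_preimage, hB, map_neg, neg_dotProduct, dotProduct_neg, neg_neg] at hx ⊢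
      exact hx)
    (hBconv.linear_preimage _) (by
      rw [Measure.addHaar_preimage_linearMap _ hdet, hBvol, ZSpan.volume_fundamentalDomain,
        LinearMap.det_toLin']
      have h1 : (Matrix.of b).det = 1 := by
        have : Matrix.of b = 1 := by
          ext i j
          simp [b, Matrix.one_apply, Pi.single_apply, eq_comm]
        rw [this, Matrix.det_one]
      rw [h1, ← ENNReal.ofReal_pow (by positivity), ← ENNReal.ofReal_mul (by positivity),
        ← ENNReal.ofReal_mul (by positivity)]
      have h8 : ENNReal.ofReal |1| * 2 ^ Module.finrank ℝ (Fin 3 → ℝ) = ENNReal.ofReal 8 := by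
        simp
        norm_num
      rw [h8]
      refine (ENNReal.ofReal_lt_ofReal_iff_of_nonneg (by norm_num)).2 ?_
      have hs : √2 ^ 3 = 2 * √2 := by
        rw [pow_succ, Real.sq_sqrt (by norm_num)]
      have hd : 1 ≤ |A.det⁻¹| * √2 := by
        rw [abs_inv, inv_mul_eq_div, le_div_iff₀ (abs_pos.2 h0), one_mul]
        exact h2
      rw [hs]
      have hpi := Real.pi_gt_three
      nlinarith [mul_le_mul_of_nonneg_right hd (show (0 : ℝ) ≤ 2 * (Real.pi * 4 / 3) by positivity)])
  have hmem : ∀ i, ∃ n : ℤ, (n : ℝ) = (x : Fin 3 → ℝ) i := by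
    intro i
    have := (b.mem_span_iff_repr_mem ℤ (x : Fin 3 → ℝ)).1 x.2 i
    simpa [b] using this
  choose z hz using hmem
  have hzx : (fun i => (z i : ℝ)) = (x : Fin 3 → ℝ) := funext hz
  refine ⟨z, ?_, ?_⟩
  · rintro rfl
    apply hx0
    ext i
    rw [← hzx]; simp
  · rw [hzx]
    exact (hB _).1 hx

lemma mulVec_intCast (P : Matrix (Fin 3) (Fin 3) ℤ) (z : Fin 3 → ℤ) :
    (P.map (Int.cast : ℤ → ℝ)) *ᵥ (fun i => (z i : ℝ)) = fun i => ((P *ᵥ z) i : ℝ) := by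
  ext i
  simp [Matrix.mulVec, dotProduct]

lemma dotProduct_intCast (x y : Fin 3 → ℤ) :
    (fun i => (x i : ℝ)) ⬝ᵥ (fun i => (y i : ℝ)) = ((x ⬝ᵥ y : ℤ) : ℝ) := by
  simp [dotProduct]

lemma det_one_add_smul_vecMulVec (t : ℝ) (e : Fin 3 → ℝ) :
    (1 + t • Matrix.vecMulVec e e).det = 1 + t * (e ⬝ᵥ e) := by
  rw [Matrix.det_fin_three]
  simp [Matrix.vecMulVec_apply, dotProduct, Fin.sum_univ_three]
  ring

/-- A lattice of covolume one on which `xᵀx` is integral, given by the basis `P / n`, contains two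
orthogonal vectors of norm one. -/
lemma exists_orthogonal_pair {n : ℕ} (hn : n ≠ 0) {P G : Matrix (Fin 3) (Fin 3) ℤ}
    (hG : P.transpose * P = ((n : ℤ) ^ 2) • G) (hdet : |P.det| = (n : ℤ) ^ 3) :
    ∃ z z' : Fin 3 → ℤ, (P *ᵥ z) ⬝ᵥ (P *ᵥ z) = (n : ℤ) ^ 2 ∧
      (P *ᵥ z') ⬝ᵥ (P *ᵥ z') = (n : ℤ) ^ 2 ∧ (P *ᵥ z) ⬝ᵥ (P *ᵥ z') = 0 := by
  have hnR : (0 : ℝ) < n := by exact_mod_cast Nat.pos_of_ne_zero hn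
  have hnZ : (0 : ℤ) < n := by exact_mod_cast Nat.pos_of_ne_zero hn
  have hP0 : P.det ≠ 0 := by
    intro h
    rw [h, abs_zero] at hdet
    exact (pow_pos hnZ 3).ne hdet
  have hform : ∀ x y : Fin 3 → ℤ, (P *ᵥ x) ⬝ᵥ (P *ᵥ y) = (n : ℤ) ^ 2 * (x ⬝ᵥ G *ᵥ y) := by
    intro x y
    rw [← smul_eq_mul, ← dotProduct_smul, ← Matrix.smul_mulVec, ← hG, ← Matrix.mulVec_mulVec,
      Matrix.dotProduct_mulVec x, Matrix.vecMul_transpose]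
  have hpos : ∀ x : Fin 3 → ℤ, x ≠ 0 → 1 ≤ x ⬝ᵥ G *ᵥ x := by
    intro x hx
    have h1 : 0 < (P *ᵥ x) ⬝ᵥ (P *ᵥ x) := by
      refine lt_of_le_of_ne (Finset.sum_nonneg fun i _ => mul_self_nonneg _) fun h => hx ?_
      exact Matrix.eq_zero_of_mulVec_eq_zero hP0 (dotProduct_self_eq_zero.1 h.symm)
    rw [hform] at h1
    exact pos_of_mul_pos_right h1 (by positivity)
  let A : Matrix (Fin 3) (Fin 3) ℝ := (n : ℝ)⁻¹ • P.map (Int.cast : ℤ → ℝ)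
  have hA : ∀ x : Fin 3 → ℤ, A *ᵥ (fun i => (x i : ℝ)) =
      (n : ℝ)⁻¹ • fun i => ((P *ᵥ x) i : ℝ) := by
    intro x
    rw [Matrix.smul_mulVec, mulVec_intCast]
  have hAdot : ∀ x y : Fin 3 → ℤ, (A *ᵥ (fun i => (x i : ℝ))) ⬝ᵥ (A *ᵥ (fun i => (y i : ℝ))) =
      ((x ⬝ᵥ G *ᵥ y : ℤ) : ℝ) := by
    intro x y
    rw [hA, hA, smul_dotProduct, dotProduct_smul, dotProduct_intCast, hform]
    push_cast
    simp only [smul_eq_mul]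
    field_simp
  have hAdet : |A.det| = 1 := by
    have h1 : (P.map (Int.cast : ℤ → ℝ)).det = (P.det : ℝ) :=
      ((Int.castRingHom ℝ).map_det P).symm
    rw [Matrix.det_smul, h1, abs_mul, ← Int.cast_abs, hdet]
    simp only [Fintype.card_fin]
    push_cast
    rw [abs_of_pos (by positivity)]
    field_simp
  have hA0 : A.det ≠ 0 := fun h => by rw [h, abs_zero] at hAdet; exact zero_ne_one hAdet
  -- The form `G` takes positive integer values on nonzero vectors, so a value below 2 is 1.
  obtain ⟨z, hz0, hz⟩ := exists_int_dotProduct_mulVec_lt_two A hA0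
    (by rw [hAdet]; exact Real.one_le_sqrt.2 (by norm_num))
  have hzz : z ⬝ᵥ G *ᵥ z = 1 := by
    rw [hAdot] at hz
    have : z ⬝ᵥ G *ᵥ z < 2 := by exact_mod_cast hz
    have := hpos z hz0
    omega
  set e := A *ᵥ (fun i => (z i : ℝ)) with he
  have hee : e ⬝ᵥ e = 1 := by rw [hAdot, hzz]; simp
  have hs : √2 ^ 2 = 2 := Real.sq_sqrt (by norm_num)
  have hEdet : (1 + (√2 - 1) • Matrix.vecMulVec e e).det = √2 := by
    rw [det_one_add_smul_vecMulVec, hee]; ring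
  -- Stretching by `√2` along `e` raises the determinant exactly to the permitted `√2`. The bound
  -- becomes `|y|² + (e ⬝ᵥ y)² < 2` in integers, which forces `|y|² = 1` and `e ⬝ᵥ y = 0`.
  obtain ⟨z', hz'0, hz'⟩ := exists_int_dotProduct_mulVec_lt_two
    ((1 + (√2 - 1) • Matrix.vecMulVec e e) * A)
    (by rw [Matrix.det_mul, hEdet]; exact mul_ne_zero (by positivity) hA0)
    (by rw [Matrix.det_mul, hEdet, abs_mul, hAdet, mul_one, abs_of_nonneg (by positivity)])
  have hstretch : ∀ y : Fin 3 → ℝ, (1 + (√2 - 1) • Matrix.vecMulVec e e) *ᵥ y =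
      y + ((√2 - 1) * (e ⬝ᵥ y)) • e := by
    intro y
    rw [Matrix.add_mulVec, Matrix.one_mulVec, Matrix.smul_mulVec, Matrix.vecMulVec_mulVec]
    simp [smul_smul]
  have hboth : (z' ⬝ᵥ G *ᵥ z') + (z ⬝ᵥ G *ᵥ z') ^ 2 < 2 := by
    rw [← Matrix.mulVec_mulVec, hstretch] at hz'
    simp only [dotProduct_add, add_dotProduct, dotProduct_smul, smul_dotProduct, smul_eq_mul,
      hee] at hz'
    rw [dotProduct_comm _ e, he, hAdot, hAdot] at hz'
    have : ((z' ⬝ᵥ G *ᵥ z' : ℤ) : ℝ) + ((z ⬝ᵥ G *ᵥ z' : ℤ) : ℝ) ^ 2 < 2 := by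
      refine lt_of_eq_of_lt ?_ hz'
      linear_combination -((z ⬝ᵥ G *ᵥ z' : ℤ) : ℝ) ^ 2 * hs
    exact_mod_cast this
  have h1 := hpos z' hz'0
  have h2 : (z ⬝ᵥ G *ᵥ z') ^ 2 < 1 := by linarith
  have h3 : z ⬝ᵥ G *ᵥ z' = 0 := by
    have := (sq_lt_one_iff_abs_lt_one _).1 h2
    exact Int.abs_lt_one_iff.1 this
  rw [h3] at hboth
  have h4 : z' ⬝ᵥ G *ᵥ z' = 1 := by
    have : z' ⬝ᵥ G *ᵥ z' < 2 := by linarith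
    omega
  exact ⟨z, z', by rw [hform, hzz, mul_one], by rw [hform, h4, mul_one], by rw [hform, h3, mul_zero]⟩

/-- A unimodular lattice with basis `P / n` has an orthonormal basis, when `P` has rank at most one
modulo `n`. -/
lemma exists_similitude_mul_eq {n : ℕ} (hn : n ≠ 0) {P G : Matrix (Fin 3) (Fin 3) ℤ}
    (hG : P.transpose * P = ((n : ℤ) ^ 2) • G) (hdet : |P.det| = (n : ℤ) ^ 3)
    {c w : Fin 3 → ℤ} (hrank : ∀ i j, (n : ℤ) ∣ P i j - c i * w j) :
    ∃ M U : Matrix (Fin 3) (Fin 3) ℤ,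
      M.transpose * M = ((n : ℤ) ^ 2) • (1 : Matrix (Fin 3) (Fin 3) ℤ) ∧ P = M * U := by
  have hnZ : (n : ℤ) ≠ 0 := by exact_mod_cast hn
  have hn2 : ((n : ℤ) ^ 2) ≠ 0 := pow_ne_zero _ hnZ
  obtain ⟨z, z', hee, hff, hef⟩ := exists_orthogonal_pair hn hG hdet
  have hmod : ∀ y : Fin 3 → ℤ, ∀ i, ∃ r, (P *ᵥ y) i = c i * (w ⬝ᵥ y) + n * r := by
    intro y i
    have : (n : ℤ) ∣ (P *ᵥ y) i - c i * (w ⬝ᵥ y) := by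
      simp only [Matrix.mulVec, dotProduct, Finset.mul_sum, ← Finset.sum_sub_distrib]
      refine Finset.dvd_sum fun j _ => ?_
      rw [← mul_assoc, ← sub_mul]
      exact (hrank i j).mul_right _
    obtain ⟨r, hr⟩ := this
    exact ⟨r, by linear_combination hr⟩
  choose r hr using hmod
  -- The third basis vector is `g = (e × f) / n`, integral because `P` has rank at most one modulo
  -- `n`.
  have hcross : ∀ i j, ∃ g, (P *ᵥ z) i * (P *ᵥ z') j - (P *ᵥ z) j * (P *ᵥ z') i = n * g := by
    intro i j
    refine ⟨c i * (w ⬝ᵥ z) * r z' j + r z i * (c j * (w ⬝ᵥ z') + n * r z' j) -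
      (c j * (w ⬝ᵥ z) * r z' i + r z j * (c i * (w ⬝ᵥ z') + n * r z' i)), ?_⟩
    rw [hr z i, hr z j, hr z' i, hr z' j]
    ring
  obtain ⟨g0, hg0⟩ := hcross 1 2
  obtain ⟨g1, hg1⟩ := hcross 2 0
  obtain ⟨g2, hg2⟩ := hcross 0 1
  set e := P *ᵥ z with he
  set f := P *ᵥ z' with hf
  have hPdot : ∀ x y : Fin 3 → ℤ, ((n : ℤ) ^ 2) ∣ (P *ᵥ x) ⬝ᵥ (P *ᵥ y) := by
    intro x y
    refine ⟨x ⬝ᵥ G *ᵥ y, ?_⟩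
    rw [← smul_eq_mul, ← dotProduct_smul, ← Matrix.smul_mulVec, ← hG, ← Matrix.mulVec_mulVec,
      Matrix.dotProduct_mulVec x, Matrix.vecMul_transpose]
  -- `n (g ⬝ᵥ P_j) = det(e, f, P_j)` is a multiple of `det P = ±n³`.
  have hgP : ∀ j, ((n : ℤ) ^ 2) ∣ g0 * P 0 j + g1 * P 1 j + g2 * P 2 j := by
    intro j
    have hD : (P * (Matrix.of ![z, z', Pi.single j 1]).transpose).det =
        n * (g0 * P 0 j + g1 * P 1 j + g2 * P 2 j) := by
      have hcol : P * (Matrix.of ![z, z', Pi.single j 1]).transpose =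
          (Matrix.of ![e, f, fun i => P i j]).transpose := by
        ext i k
        fin_cases k
        · rfl
        · rfl
        · simp [Matrix.mul_apply, Pi.single_apply]
      rw [hcol, Matrix.det_transpose, Matrix.det_fin_three]
      simp only [Matrix.of_apply, Matrix.cons_val]
      linear_combination P 0 j * hg0 + P 1 j * hg1 + P 2 j * hg2
    rw [Matrix.det_mul] at hD
    have h3 : (n : ℤ) ^ 3 ∣ n * (g0 * P 0 j + g1 * P 1 j + g2 * P 2 j) := by
      rw [← hD, ← hdet]
      exact (abs_dvd_self _).mul_right _
    rw [pow_succ'] at h3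
    exact (mul_dvd_mul_iff_left hnZ).1 h3
  simp only [dotProduct, Fin.sum_univ_three] at hee hff hef
  have hge : g0 * e 0 + g1 * e 1 + g2 * e 2 = 0 := by
    apply mul_left_cancel₀ hnZ
    linear_combination -e 0 * hg0 - e 1 * hg1 - e 2 * hg2
  have hgf : g0 * f 0 + g1 * f 1 + g2 * f 2 = 0 := by
    apply mul_left_cancel₀ hnZ
    linear_combination -f 0 * hg0 - f 1 * hg1 - f 2 * hg2
  -- Lagrange's identity for `|e × f|²`.
  have hgg : g0 * g0 + g1 * g1 + g2 * g2 = (n : ℤ) ^ 2 := by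
    apply mul_left_cancel₀ hn2
    have h0 := congrArg (fun t => t * t) hg0
    have h1 := congrArg (fun t => t * t) hg1
    have h2 := congrArg (fun t => t * t) hg2
    have h3 := congrArg (fun t => t * t) hef
    have h4 : (e 0 * e 0 + e 1 * e 1 + e 2 * e 2) * (f 0 * f 0 + f 1 * f 1 + f 2 * f 2) =
      (n : ℤ) ^ 2 * (n : ℤ) ^ 2 := by rw [hee, hff]
    linear_combination -h0 - h1 - h2 - h3 + h4
  let M : Matrix (Fin 3) (Fin 3) ℤ := (Matrix.of ![e, f, ![g0, g1, g2]]).transpose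
  have hM : M.transpose * M = ((n : ℤ) ^ 2) • (1 : Matrix (Fin 3) (Fin 3) ℤ) := by
    ext i j
    simp only [M, Matrix.transpose_transpose, Matrix.mul_apply, Fin.sum_univ_three,
      Matrix.transpose_apply, Matrix.of_apply, Matrix.smul_apply, smul_eq_mul]
    fin_cases i <;> fin_cases j <;>
      simp only [Fin.zero_eta, Fin.mk_one, Fin.reduceFinMk, Matrix.cons_val, Matrix.one_apply_eq,
        mul_one, ne_eq, Fin.reduceEq, not_false_eq_true, Matrix.one_apply_ne, mul_zero] <;>
      linarith
  have hdvd : ∀ i j, ((n : ℤ) ^ 2) ∣ (M.transpose * P) i j := by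
    intro i j
    have hcol : P *ᵥ Pi.single j 1 = fun i => P i j := by
      rw [Matrix.mulVec_single_one]; rfl
    fin_cases i
    · have := hPdot z (Pi.single j 1)
      rw [hcol] at this
      exact this
    · have := hPdot z' (Pi.single j 1)
      rw [hcol] at this
      exact this
    · have := hgP j
      simpa [M, Matrix.mul_apply, Fin.sum_univ_three] using this
  choose U hU using hdvd
  refine ⟨M, Matrix.of U, hM, ?_⟩
  have hMP : M.transpose * P = ((n : ℤ) ^ 2) • Matrix.of U := by
    ext i j; simp [hU]
  apply smul_right_injective _ hn2
  simp only
  rw [← Matrix.mul_smul, ← hMP, ← mul_assoc, mul_transpose_of_transpose_mul hn hM,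
    Matrix.smul_mul, one_mul]

/-- Existence of similitudes of prime level through a given isotropic vector, when two of the
coordinates, in positions `0` and `1`, are units. -/
lemma exists_similitude_of_prime_aux {p : ℕ} (hp : p.Prime) {v : Fin 3 → ℤ}
    (hv : ((p : ℤ) ^ 2) ∣ v ⬝ᵥ v) (h0 : ¬ (p : ℤ) ∣ v 0) (h1 : ¬ (p : ℤ) ∣ v 1) :
    ∃ M : Matrix (Fin 3) (Fin 3) ℤ,
      M.transpose * M = ((p : ℤ) ^ 2) • (1 : Matrix (Fin 3) (Fin 3) ℤ) ∧ ∃ a, M *ᵥ a = v := by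
  have hpZ : Prime (p : ℤ) := Nat.prime_iff_prime_int.1 hp
  have hcop : ∀ x : ℤ, ¬ (p : ℤ) ∣ x → IsCoprime (p : ℤ) x := fun x hx =>
    (Prime.coprime_iff_not_dvd hpZ).2 hx
  -- `k` inverts `v 0` modulo `p²`, so `k v ≡ (1, b, c)` there; below, `b'` inverts `b` modulo `p`.
  obtain ⟨q, k, hk⟩ := (hcop _ h0).pow_left (m := 2)
  have hb : ¬ (p : ℤ) ∣ k * v 1 := by
    intro h
    rcases hpZ.dvd_or_dvd h with h | h
    · have : (p : ℤ) ∣ 1 := by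
        rw [← hk]
        exact dvd_add ((dvd_pow_self _ two_ne_zero).mul_left _) (h.mul_right _)
      exact hpZ.not_isUnit (isUnit_of_dvd_one this)
    · exact h1 h
  obtain ⟨q', b', hb'⟩ := hcop _ hb
  obtain ⟨m, hm⟩ := hv
  simp only [dotProduct, Fin.sum_univ_three] at hm
  set b := k * v 1 with hbdef
  set c := k * v 2 with hcdef
  have hiso : 1 + b ^ 2 + c ^ 2 = (p : ℤ) ^ 2 * (k ^ 2 * m + q * (2 - q * (p : ℤ) ^ 2)) := by
    rw [hbdef, hcdef]
    linear_combination k ^ 2 * hm - (1 + k * v 0 - q * (p : ℤ) ^ 2) * hk +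
      2 * (-q * (p : ℤ) ^ 2) * hk + 2 * (q * (p : ℤ) ^ 2) * hk
  -- With `u = (1, b, c)`, the columns of `P` span `ℤu + p {x | x ⬝ᵥ u ≡ 0 mod p}`, which is `p`
  -- times the neighbour lattice of `ℤ³` at `u`. Only the first column survives modulo `p`.
  let P : Matrix (Fin 3) (Fin 3) ℤ := !![1, 0, 0; b, p * (-(b' * c)), p ^ 2; c, p, 0]
  have hbt : b * (-(b' * c)) + c = p * (q' * c) := by linear_combination -c * hb'
  let s := k ^ 2 * m + q * (2 - q * (p : ℤ) ^ 2)
  let G : Matrix (Fin 3) (Fin 3) ℤ :=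
    !![s, q' * c, b; q' * c, (b' * c) ^ 2 + 1, p * (-(b' * c)); b, p * (-(b' * c)), p ^ 2]
  have hG : P.transpose * P = ((p : ℤ) ^ 2) • G := by
    ext i j
    simp only [P, G, Matrix.mul_apply, Fin.sum_univ_three, Matrix.transpose_apply,
      Matrix.smul_apply, smul_eq_mul]
    fin_cases i <;> fin_cases j <;>
      simp only [Fin.zero_eta, Fin.mk_one, Fin.reduceFinMk, Matrix.of_apply, Matrix.cons_val]
    · linear_combination hiso
    · linear_combination (p : ℤ) * hbt
    · ring
    · linear_combination (p : ℤ) * hbt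
    · ring
    · ring
    · ring
    · ring
    · ring
  have hdet : |P.det| = (p : ℤ) ^ 3 := by
    have : P.det = -(p : ℤ) ^ 3 := by
      rw [Matrix.det_fin_three]
      simp only [P, Matrix.of_apply, Matrix.cons_val]
      ring
    rw [this, abs_neg, abs_of_nonneg (by positivity)]
  obtain ⟨M, U, hM, hPM⟩ := exists_similitude_mul_eq hp.ne_zero hG hdet (c := ![1, b, c])
    (w := ![1, 0, 0]) (by
      intro i j
      fin_cases i <;> fin_cases j <;> simp [P, pow_two])
  -- `v 0 • u` agrees with `v` modulo `p²`; the remaining multiple of `p²` is reached because `M Mᵀ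
  -- = p²`.
  refine ⟨M, hM, v 0 • (U *ᵥ Pi.single 0 1) + M.transpose *ᵥ ![0, q * v 1, q * v 2], ?_⟩
  rw [Matrix.mulVec_add, Matrix.mulVec_smul, Matrix.mulVec_mulVec, ← hPM, Matrix.mulVec_mulVec,
    mul_transpose_of_transpose_mul hp.ne_zero hM, Matrix.mulVec_single_one, Matrix.smul_mulVec,
    Matrix.one_mulVec]
  ext i
  fin_cases i <;>
    simp only [P, Matrix.col, Matrix.transpose_apply, Matrix.of_apply, Matrix.cons_val,
      Pi.add_apply, Pi.smul_apply, smul_eq_mul, Fin.zero_eta, Fin.mk_one, Fin.reduceFinMk]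
  · ring
  · rw [hbdef]; linear_combination v 1 * hk
  · rw [hcdef]; linear_combination v 2 * hk

lemma exists_similitude_of_prime {p : ℕ} (hp : p.Prime) {v : Fin 3 → ℤ}
    (hv : ((p : ℤ) ^ 2) ∣ v ⬝ᵥ v) (h0 : ∃ i, ¬ (p : ℤ) ∣ v i) :
    ∃ M : Matrix (Fin 3) (Fin 3) ℤ,
      M.transpose * M = ((p : ℤ) ^ 2) • (1 : Matrix (Fin 3) (Fin 3) ℤ) ∧ ∃ a, M *ᵥ a = v := by
  have hpZ : Prime (p : ℤ) := Nat.prime_iff_prime_int.1 hp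
  -- Were only one coordinate prime to `p`, its square would be congruent to `v ⬝ᵥ v`, hence to 0.
  -- The two coordinates found are then permuted into positions 0 and 1.
  obtain ⟨i, j, hij, hi, hj⟩ : ∃ i j, i ≠ j ∧ ¬ (p : ℤ) ∣ v i ∧ ¬ (p : ℤ) ∣ v j := by
    obtain ⟨i, hi⟩ := h0
    by_contra! hcon
    have h1 : (p : ℤ) ∣ v i * v i := by
      have h2 : (p : ℤ) ∣ ∑ j, v j * v j := (dvd_pow_self _ two_ne_zero).trans hv
      rw [← Finset.add_sum_erase _ _ (Finset.mem_univ i)] at h2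
      refine (dvd_add_left (Finset.dvd_sum fun j hj => ?_)).1 h2
      exact (hcon i j (Finset.ne_of_mem_erase hj).symm hi).mul_right _
    exact hi ((hpZ.dvd_or_dvd h1).elim id id)
  obtain ⟨σ, hσ0, hσ1⟩ : ∃ σ : Equiv.Perm (Fin 3), σ 0 = i ∧ σ 1 = j :=
    (by decide : ∀ i j : Fin 3, i ≠ j → ∃ σ : Equiv.Perm (Fin 3), σ 0 = i ∧ σ 1 = j) i j hij
  obtain ⟨M, hM, a, ha⟩ := exists_similitude_of_prime_aux hp (v := v ∘ σ)
    (by rwa [show v ∘ σ ⬝ᵥ v ∘ σ = v ⬝ᵥ v from Equiv.sum_comp σ fun x => v x * v x])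
    (by simpa [hσ0]) (by simpa [hσ1])
  refine ⟨M.submatrix σ.symm id, ?_, a, ?_⟩
  · rw [← hM]
    ext k l
    simp only [Matrix.mul_apply, Matrix.transpose_apply, Matrix.submatrix_apply, id]
    exact Equiv.sum_comp σ.symm fun x => M x k * M x l
  · ext k
    have := congrFun ha (σ.symm k)
    simpa [Matrix.mulVec] using this

/-- Induction on a factorization `ℓ = m n`: writing `v = A a` with `A` of scale `m` divides the norm
by `m²`, and `a` stays primitive at the primes of `n`, so `a = B b` with `B` of scale `n`. The
product `A B` works. -/
lemma exists_similitude (ℓ : ℕ) (hℓ : ℓ ≠ 0) : ∀ {v : Fin 3 → ℤ},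
    ((ℓ : ℤ) ^ 2) ∣ v ⬝ᵥ v → (∀ p : ℕ, p.Prime → p ∣ ℓ → ∃ i, ¬ (p : ℤ) ∣ v i) →
    ∃ M : Matrix (Fin 3) (Fin 3) ℤ,
      M.transpose * M = ((ℓ : ℤ) ^ 2) • (1 : Matrix (Fin 3) (Fin 3) ℤ) ∧ ∃ a, M *ᵥ a = v := by
  induction ℓ using Nat.recOnMul with
  | zero => exact absurd rfl hℓ
  | one => exact fun {v} _ _ => ⟨1, by simp, v, by simp⟩
  | prime p hp => exact fun {v} hv hprim => exists_similitude_of_prime hp hv (hprim p hp dvd_rfl)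
  | mul m n ihm ihn =>
    intro v hv hprim
    have hm : m ≠ 0 := left_ne_zero_of_mul hℓ
    have hn : n ≠ 0 := right_ne_zero_of_mul hℓ
    obtain ⟨t, ht⟩ := hv
    push_cast at ht
    obtain ⟨A, hA, a, rfl⟩ := ihm hm (v := v) ⟨(n : ℤ) ^ 2 * t, by rw [ht]; ring⟩
      fun p hp hpm => hprim p hp (hpm.mul_right n)
    obtain ⟨B, hB, b, rfl⟩ := ihn hn (v := a)
      ⟨t, by
        rw [dvd_dotProduct_mulVec hA] at ht
        apply mul_left_cancel₀ (pow_ne_zero 2 (show (m : ℤ) ≠ 0 by exact_mod_cast hm))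
        rw [ht]; ring⟩
      (by
        intro p hp hpn
        by_contra! hcon
        obtain ⟨i, hi⟩ := hprim p hp (hpn.mul_left m)
        apply hi
        rw [Matrix.mulVec, dotProduct]
        exact Finset.dvd_sum fun j _ => (hcon j).mul_left _)
    refine ⟨A * B, ?_, b, by rw [Matrix.mulVec_mulVec]⟩
    rw [Matrix.transpose_mul, mul_assoc, ← mul_assoc A.transpose, hA, Matrix.smul_mul, one_mul,
      Matrix.mul_smul, hB, smul_smul]
    congr 1
    push_cast; ring

/-- Every unimodular isotropic vector modulo an odd `ℓ` lies in the column space of the reduction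
of a primitive similitude. -/
lemma exists_primitiveSimilitude_mulVec {ℓ : ℕ} (hodd : Odd ℓ) {v : Fin 3 → ZMod ℓ}
    (hv : v ∈ isotropicVectors (ZMod ℓ)) :
    ∃ M ∈ primitiveSimilitudes ℓ, ∃ a, modMat ℓ M *ᵥ a = v := by
  have hℓ : ℓ ≠ 0 := hodd.pos.ne'
  obtain ⟨h0, b, hb⟩ := hv
  obtain ⟨v, rfl⟩ := exists_intCast_eq v
  obtain ⟨b, rfl⟩ := exists_intCast_eq b
  have hcast : ∀ x y : Fin 3 → ℤ, (fun i => (x i : ZMod ℓ)) ⬝ᵥ (fun i => (y i : ZMod ℓ)) =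
      ((x ⬝ᵥ y : ℤ) : ZMod ℓ) := by
    intro x y; simp [dotProduct]
  rw [hcast, ZMod.intCast_zmod_eq_zero_iff_dvd] at h0
  obtain ⟨m, hm⟩ := h0
  rw [hcast] at hb
  have hb' : (ℓ : ℤ) ∣ b ⬝ᵥ v - 1 := by
    rw [← ZMod.intCast_zmod_eq_zero_iff_dvd]
    push_cast
    rw [hb, sub_self]
  obtain ⟨r, hr⟩ := hb'
  obtain ⟨h, hh⟩ := hodd
  have hh' : (ℓ : ℤ) = 2 * h + 1 := by exact_mod_cast hh
  -- Hensel-type correction of the lift: with `v ⬝ᵥ v = ℓ m`, `b ⬝ᵥ v ≡ 1` and `2h + 1 = ℓ`, the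
  -- first-order terms of `w ⬝ᵥ w` add up to `ℓ m (1 + 2h) = ℓ² m`.
  let w : Fin 3 → ℤ := v + ((ℓ : ℤ) * (m * h)) • b
  have hw : ((ℓ : ℤ) ^ 2) ∣ w ⬝ᵥ w := by
    simp only [w, dotProduct_add, add_dotProduct, dotProduct_smul, smul_dotProduct, smul_eq_mul,
      dotProduct_comm v b, hm]
    refine ⟨m + 2 * m * h * r + (m * h) ^ 2 * (b ⬝ᵥ b), ?_⟩
    linear_combination 2 * (ℓ : ℤ) * m * h * hr - (ℓ : ℤ) * m * hh'
  have hwv : (fun i => (w i : ZMod ℓ)) = fun i => (v i : ZMod ℓ) := by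
    ext i; simp [w]
  have hprim : ∀ p : ℕ, p.Prime → p ∣ ℓ → ∃ i, ¬ (p : ℤ) ∣ w i := by
    intro p hp hpl
    by_contra! hcon
    have hpl' : (p : ℤ) ∣ ℓ := Int.natCast_dvd_natCast.2 hpl
    have h1 : (p : ℤ) ∣ b ⬝ᵥ w := Finset.dvd_sum fun j _ => (hcon j).mul_left _
    have h2 : b ⬝ᵥ w = 1 + ℓ * (r + m * h * (b ⬝ᵥ b)) := by
      simp only [w, dotProduct_add, dotProduct_smul, smul_eq_mul]
      linear_combination hr
    rw [h2] at h1
    have h3 : (p : ℤ) ∣ 1 := (dvd_add_left (hpl'.mul_right _)).1 h1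
    exact (Nat.prime_iff_prime_int.1 hp).not_isUnit (isUnit_of_dvd_one h3)
  obtain ⟨M, hM, a, ha⟩ := exists_similitude ℓ hℓ hw hprim
  refine ⟨M, ⟨hM, fun p hp hpl => ?_⟩, fun i => (a i : ZMod ℓ), ?_⟩
  · by_contra! hcon
    obtain ⟨i, hi⟩ := hprim p hp hpl
    apply hi
    rw [← ha]
    rw [Matrix.mulVec, dotProduct]
    exact Finset.dvd_sum fun j _ => (hcon i j).mul_right _
  · rw [modMat_mulVec, ha, hwv]

/-- The number of rational orthogonal `3 × 3` matrices of odd level `ℓ`. -/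
lemma ncard_primitiveSimilitudes {ℓ : ℕ} (hodd : Odd ℓ) :
    (Set.ncard (primitiveSimilitudes ℓ) : ℝ) =
      48 * (ℓ * ∏ p ∈ ℓ.primeFactors, (1 + 1 / (p : ℝ))) := by
  classical
  have hℓ : ℓ ≠ 0 := hodd.pos.ne'
  have : NeZero ℓ := ⟨hℓ⟩
  have hfin := primitiveSimilitudes_finite ℓ
  have hfin' : (isotropicVectors (ZMod ℓ)).Finite := Set.toFinite _
  -- Double counting of the incidences between similitudes and the vectors on their lines.
  have hcount := Finset.card_mul_eq_card_mul (s := hfin.toFinset) (t := hfin'.toFinset)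
    (fun M v => ∃ a, modMat ℓ M *ᵥ a = v) (m := ℓ.totient) (n := 48)
    (by
      intro M hM
      rw [← ncard_isotropic_mulVec (hfin.mem_toFinset.1 hM), ← Set.ncard_coe_finset]
      congr 1
      ext v
      simp [Finset.bipartiteAbove])
    (by
      intro v hv
      have hv' := hfin'.mem_toFinset.1 hv
      rw [← ncard_mulVec_eq hodd hv'.2 (exists_primitiveSimilitude_mulVec hodd hv'),
        ← Set.ncard_coe_finset]
      congr 1
      ext M
      simp [Finset.bipartiteBelow])
  rw [← Set.ncard_eq_toFinset_card _ hfin, ← Set.ncard_eq_toFinset_card _ hfin'] at hcount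
  have hφ : (ℓ.totient : ℝ) ≠ 0 := by
    exact_mod_cast (Nat.totient_pos.2 hodd.pos).ne'
  have hI := card_isotropicVectors_eq hodd
  rw [Nat.card_coe_set_eq] at hI
  have hcount' : (Set.ncard (primitiveSimilitudes ℓ) : ℝ) * ℓ.totient =
      Set.ncard (isotropicVectors (ZMod ℓ)) * 48 := by exact_mod_cast hcount
  apply mul_right_cancel₀ hφ
  rw [hcount', hI]
  ring

/-! ### Symmetric matrices kept integral by conjugation -/

/-- The symmetric matrix with given upper-triangular entries. -/
def symmOfUpper {R : Type*} (t : {p : Fin 3 × Fin 3 // p.1 ≤ p.2} → R) :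
    Matrix (Fin 3) (Fin 3) R :=
  Matrix.of fun i j => if h : i ≤ j then t ⟨(i, j), h⟩ else t ⟨(j, i), (not_le.1 h).le⟩

lemma symmOfUpper_eq {R : Type*} {X : Matrix (Fin 3) (Fin 3) R} (hX : X.IsSymm) :
    symmOfUpper (fun p => X p.1.1 p.1.2) = X := by
  ext i j
  simp only [symmOfUpper, Matrix.of_apply]
  split_ifs
  · rfl
  · exact hX.apply i j

lemma symmOfUpper_isSymm {R : Type*} (t : {p : Fin 3 × Fin 3 // p.1 ≤ p.2} → R) :
    (symmOfUpper t).IsSymm := by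
  ext i j
  simp only [symmOfUpper, Matrix.of_apply, Matrix.transpose_apply]
  rcases lt_trichotomy i j with h | h | h
  · rw [dif_neg (not_le.2 h), dif_pos h.le]
  · subst h; rfl
  · rw [dif_pos h.le, dif_neg (not_le.2 h)]

lemma symmOfUpper_add {R : Type*} [Add R] (s t : {p : Fin 3 × Fin 3 // p.1 ≤ p.2} → R) :
    symmOfUpper (s + t) = symmOfUpper s + symmOfUpper t := by
  ext i j
  simp only [symmOfUpper, Matrix.of_apply, Matrix.add_apply]
  split_ifs <;> rfl

/-- The product of the symmetric matrix with given upper-triangular entries and a fixed vector. -/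
def symmMulVec {R : Type*} [CommRing R] (v : Fin 3 → R) :
    ({p : Fin 3 × Fin 3 // p.1 ≤ p.2} → R) →+ (Fin 3 → R) :=
  AddMonoidHom.mk' (fun t => symmOfUpper t *ᵥ v) fun s t => by
    rw [symmOfUpper_add, Matrix.add_mulVec]

lemma symmMulVec_surjective {R : Type*} [CommRing R] {v b : Fin 3 → R} (hb : b ⬝ᵥ v = 1) :
    Function.Surjective (symmMulVec v) := by
  intro y
  -- The first term sends `v` to `y`; the second makes the matrix symmetric, and the third cancels
  -- the resulting error `(y ⬝ᵥ v) b`.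
  let X : Matrix (Fin 3) (Fin 3) R :=
    Matrix.vecMulVec y b + Matrix.vecMulVec b y - (y ⬝ᵥ v) • Matrix.vecMulVec b b
  have hX : X.IsSymm := by
    ext i j
    simp only [X, Matrix.transpose_apply, Matrix.sub_apply, Matrix.add_apply,
      Matrix.vecMulVec_apply, Matrix.smul_apply, smul_eq_mul]
    ring
  refine ⟨fun p => X p.1.1 p.1.2, ?_⟩
  change symmOfUpper (fun p => X p.1.1 p.1.2) *ᵥ v = y
  rw [symmOfUpper_eq hX]
  simp only [X, Matrix.sub_mulVec, Matrix.add_mulVec, Matrix.smul_mulVec,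
    Matrix.vecMulVec_mulVec, hb]
  ext i
  simp

section Similitude

variable {ℓ : ℕ} {M : Matrix (Fin 3) (Fin 3) ℤ}

/-- Since `M⁻¹ = Mᵀ / ℓ²`, the lattice `Mℤ³` is the kernel of `Mᵀ` modulo `ℓ²`. -/
lemma exists_mulVec_eq_iff (hℓ : ℓ ≠ 0)
    (hM : M.transpose * M = ((ℓ : ℤ) ^ 2) • (1 : Matrix (Fin 3) (Fin 3) ℤ)) (y : Fin 3 → ℤ) :
    (∃ z, M *ᵥ z = y) ↔ ∀ i, ((ℓ : ℤ) ^ 2) ∣ (M.transpose *ᵥ y) i := by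
  constructor
  · rintro ⟨z, rfl⟩ i
    rw [Matrix.mulVec_mulVec, hM, Matrix.smul_mulVec, Matrix.one_mulVec]
    exact dvd_mul_right _ _
  · intro h
    choose z hz using h
    refine ⟨z, ?_⟩
    have h1 : M.transpose *ᵥ y = ((ℓ : ℤ) ^ 2) • z := funext hz
    apply smul_right_injective _ (pow_ne_zero 2 (show (ℓ : ℤ) ≠ 0 by exact_mod_cast hℓ))
    simp only
    rw [← Matrix.mulVec_smul, ← h1, Matrix.mulVec_mulVec, mul_transpose_of_transpose_mul hℓ hM,
      Matrix.smul_mulVec, Matrix.one_mulVec]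

/-- One vector controls the whole matrix. The hypothesis says `X M a = M u`. Splitting the columns
of `M` as multiples of `M a` plus `ℓ s`, the terms containing `X M a` become products with `M u`,
again split along `M a`; symmetry of `X` handles the mixed term, and the last one carries `ℓ²`
explicitly. -/
lemma dvd_conj_apply (hℓ : ℓ ≠ 0)
    (hM : M.transpose * M = ((ℓ : ℤ) ^ 2) • (1 : Matrix (Fin 3) (Fin 3) ℤ))
    {a : Fin 3 → ℤ} {b : Fin 3 → ZMod ℓ}
    (hb : b ⬝ᵥ (fun i => ((M *ᵥ a) i : ZMod ℓ)) = 1)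
    {X : Matrix (Fin 3) (Fin 3) ℤ} (hX : X.IsSymm)
    (h : ∀ i, ((ℓ : ℤ) ^ 2) ∣ (M.transpose *ᵥ (X *ᵥ (M *ᵥ a))) i) (i j : Fin 3) :
    ((ℓ : ℤ) ^ 2) ∣ (M.transpose * X * M) i j := by
  obtain ⟨u, hu⟩ := (exists_mulVec_eq_iff hℓ hM _).2 h
  obtain ⟨w, s, hs, -, -⟩ := exists_mulVec_eq_smul_add hℓ hM hb (Pi.single i 1)
  obtain ⟨w', s', hs', k', hk'⟩ := exists_mulVec_eq_smul_add hℓ hM hb (Pi.single j 1)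
  obtain ⟨w'', s'', hs'', -, -⟩ := exists_mulVec_eq_smul_add hℓ hM hb u
  have hsymm : ∀ x y : Fin 3 → ℤ, x ⬝ᵥ X *ᵥ y = y ⬝ᵥ X *ᵥ x := by
    intro x y
    rw [Matrix.dotProduct_mulVec, ← Matrix.mulVec_transpose, hX, dotProduct_comm]
  have hent : (M.transpose * X * M) i j =
      (M *ᵥ Pi.single i 1) ⬝ᵥ X *ᵥ (M *ᵥ Pi.single j 1) := by
    rw [Matrix.mulVec_mulVec, Matrix.mulVec_single_one, Matrix.mulVec_single_one, mul_assoc]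
    rfl
  have h1 : (M *ᵥ Pi.single i 1) ⬝ᵥ X *ᵥ (M *ᵥ a) = (ℓ : ℤ) ^ 2 * (Pi.single i 1 ⬝ᵥ u) := by
    rw [← hu, dvd_dotProduct_mulVec hM]
  have h2 : (M *ᵥ a) ⬝ᵥ X *ᵥ s' = ℓ * (w'' * k' + s' ⬝ᵥ s'') := by
    rw [hsymm, ← hu, hs'', dotProduct_add, dotProduct_smul, dotProduct_smul, dotProduct_comm, hk',
      smul_eq_mul, smul_eq_mul]
    ring
  rw [hent, hs', Matrix.mulVec_add, Matrix.mulVec_smul, Matrix.mulVec_smul, dotProduct_add,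
    dotProduct_smul, dotProduct_smul, h1, hs, add_dotProduct, smul_dotProduct, smul_dotProduct, h2]
  simp only [smul_eq_mul]
  exact ⟨w' * (Pi.single i 1 ⬝ᵥ u) + w * (w'' * k' + s' ⬝ᵥ s'') + s ⬝ᵥ X *ᵥ s', by ring⟩

lemma index_range_mulVec (M : Matrix (Fin 3) (Fin 3) ℤ) (h : M.det ≠ 0) :
    (LinearMap.range (Matrix.toLin' M)).toAddSubgroup.index = M.det.natAbs := by
  have hinj : Function.Injective (Matrix.toLin' M) := by
    rw [← LinearMap.ker_eq_bot, LinearMap.ker_eq_bot']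
    intro x hx
    exact Matrix.eq_zero_of_mulVec_eq_zero h (by simpa using hx)
  have := Submodule.natAbs_det_equiv (LinearMap.range (Matrix.toLin' M))
    (LinearEquiv.ofInjective (Matrix.toLin' M) hinj)
  rw [← LinearMap.det_toLin' M]
  exact this.symm

/-- Reduction of integer vectors, as an additive homomorphism. -/
def vecCast (m : ℕ) : (Fin 3 → ℤ) →+ (Fin 3 → ZMod m) :=
  AddMonoidHom.mk' (fun z i => (z i : ZMod m)) fun x y => by ext i; simp

/-- The upper-triangular parts of the symmetric matrices `X` modulo `ℓ²` with `Mᵀ X M = 0`. -/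
def conjKernel (ℓ : ℕ) (M : Matrix (Fin 3) (Fin 3) ℤ) :
    Set ({p : Fin 3 × Fin 3 // p.1 ≤ p.2} → ZMod (ℓ ^ 2)) :=
  {t | (modMat (ℓ ^ 2) M).transpose * symmOfUpper t * modMat (ℓ ^ 2) M = 0}

/-- The subgroup is the preimage, under the surjection `X ↦ X v` with `v = M a` unimodular, of the
kernel of `Mᵀ` modulo `ℓ²`. Surjections preserve the index under preimage, so it can be computed in
`ℤ³`, where the kernel becomes `Mℤ³`. -/
lemma exists_addSubgroup_eq_conjKernel (hℓ : ℓ ≠ 0) (hM : M ∈ primitiveSimilitudes ℓ) :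
    ∃ H : AddSubgroup ({p : Fin 3 × Fin 3 // p.1 ≤ p.2} → ZMod (ℓ ^ 2)),
      (H : Set _) = conjKernel ℓ M ∧ H.index = ℓ ^ 3 := by
  obtain ⟨a, ha⟩ := exists_mulVec_unimodular hM
  obtain ⟨b, hb⟩ := exists_dotProduct_modEq_one (m := ℓ ^ 2) (v := M *ᵥ a)
    fun p hp hpl => ha p hp (hp.dvd_of_dvd_pow hpl)
  have hcast : ∀ (m : ℕ) (x y : Fin 3 → ℤ), (fun i => (x i : ZMod m)) ⬝ᵥ (fun i => (y i : ZMod m)) =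
      ((x ⬝ᵥ y : ℤ) : ZMod m) := by
    intro m x y; simp [dotProduct]
  have hb2 : (fun i => (b i : ZMod (ℓ ^ 2))) ⬝ᵥ (fun i => ((M *ᵥ a) i : ZMod (ℓ ^ 2))) = 1 := by
    rw [hcast, ← sub_eq_zero]
    exact_mod_cast (ZMod.intCast_zmod_eq_zero_iff_dvd _ _).2 hb
  have hb1 : (fun i => (b i : ZMod ℓ)) ⬝ᵥ (fun i => ((M *ᵥ a) i : ZMod ℓ)) = 1 := by
    rw [hcast, ← sub_eq_zero]
    refine mod_cast (ZMod.intCast_zmod_eq_zero_iff_dvd _ ℓ).2 (dvd_trans ?_ hb)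
    exact_mod_cast dvd_pow_self ℓ two_ne_zero
  let ψ : (Fin 3 → ZMod (ℓ ^ 2)) →+ (Fin 3 → ZMod (ℓ ^ 2)) :=
    (Matrix.toLin' (modMat (ℓ ^ 2) M).transpose).toAddMonoidHom
  have hψ : ∀ y, ψ y = (modMat (ℓ ^ 2) M).transpose *ᵥ y := fun y => rfl
  have hψcast : ∀ y : Fin 3 → ℤ, ψ (fun i => (y i : ZMod (ℓ ^ 2))) = 0 ↔
      ∀ i, ((ℓ : ℤ) ^ 2) ∣ (M.transpose *ᵥ y) i := by
    intro y
    have hT : (modMat (ℓ ^ 2) M).transpose = modMat (ℓ ^ 2) M.transpose := rfl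
    rw [hψ, hT, modMat_mulVec, funext_iff]
    refine forall_congr' fun i => ?_
    rw [Pi.zero_apply, ZMod.intCast_zmod_eq_zero_iff_dvd]
    push_cast
    rfl
  let V : Fin 3 → ZMod (ℓ ^ 2) := fun i => ((M *ᵥ a) i : ZMod (ℓ ^ 2))
  refine ⟨ψ.ker.comap (symmMulVec V), ?_, ?_⟩
  · ext t
    obtain ⟨t', rfl⟩ : ∃ t' : {p : Fin 3 × Fin 3 // p.1 ≤ p.2} → ℤ,
        (fun p => (t' p : ZMod (ℓ ^ 2))) = t := by
      choose t' h using fun p => ZMod.intCast_surjective (t p)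
      exact ⟨t', funext h⟩
    have hsym : symmOfUpper (fun p => (t' p : ZMod (ℓ ^ 2))) = modMat (ℓ ^ 2) (symmOfUpper t') := by
      ext i j
      simp only [symmOfUpper, modMat, Matrix.of_apply, Matrix.map_apply]
      split_ifs <;> rfl
    have hker : (fun p => (t' p : ZMod (ℓ ^ 2))) ∈
        ((ψ.ker.comap (symmMulVec V) : AddSubgroup _) : Set _) ↔
        ∀ i, ((ℓ : ℤ) ^ 2) ∣ (M.transpose *ᵥ (symmOfUpper t' *ᵥ (M *ᵥ a))) i := by
      rw [← hψcast, ← modMat_mulVec, ← hsym]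
      rfl
    have hconj : (fun p => (t' p : ZMod (ℓ ^ 2))) ∈ conjKernel ℓ M ↔
        ∀ i j, ((ℓ : ℤ) ^ 2) ∣ (M.transpose * symmOfUpper t' * M) i j := by
      have hT : (modMat (ℓ ^ 2) M).transpose = modMat (ℓ ^ 2) M.transpose := rfl
      rw [conjKernel, Set.mem_ofPred_eq, hsym, hT, ← modMat_mul, ← modMat_mul, ← Matrix.ext_iff]
      refine forall_congr' fun i => forall_congr' fun j => ?_
      rw [modMat, Matrix.map_apply, Matrix.zero_apply, ZMod.intCast_zmod_eq_zero_iff_dvd]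
      push_cast
      rfl
    rw [hker, hconj]
    constructor
    · intro h
      exact dvd_conj_apply hℓ hM.1 hb1 (symmOfUpper_isSymm t') h
    · intro h i
      rw [Matrix.mulVec_mulVec, Matrix.mulVec_mulVec, Matrix.mulVec, dotProduct]
      exact Finset.dvd_sum fun j _ => (h i j).mul_right _
  · rw [AddSubgroup.index_comap_of_surjective _ (symmMulVec_surjective hb2)]
    have hsurj : Function.Surjective (vecCast (ℓ ^ 2)) := fun y => exists_intCast_eq y
    rw [← AddSubgroup.index_comap_of_surjective _ hsurj]
    have hrange : ψ.ker.comap (vecCast (ℓ ^ 2)) =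
        (LinearMap.range (Matrix.toLin' M)).toAddSubgroup := by
      ext y
      have h1 : y ∈ ψ.ker.comap (vecCast (ℓ ^ 2)) ↔ ψ (fun i => (y i : ZMod (ℓ ^ 2))) = 0 := Iff.rfl
      rw [h1, hψcast, ← exists_mulVec_eq_iff hℓ hM.1]
      rfl
    have hd : M.det.natAbs = ℓ ^ 3 := by
      have := Int.natAbs_eq_iff_sq_eq.2 (det_sq_eq hM.1)
      rw [this]
      simp [Int.natAbs_pow]
    have hd0 : M.det ≠ 0 := by
      intro h0
      rw [h0] at hd
      exact pow_ne_zero 3 hℓ hd.symm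
    rw [hrange, index_range_mulVec M hd0, hd]

lemma card_conjKernel_mul (hℓ : ℓ ≠ 0) (hM : M ∈ primitiveSimilitudes ℓ) :
    Nat.card (conjKernel ℓ M) * ℓ ^ 3 = (ℓ ^ 2) ^ 6 := by
  obtain ⟨H, hH, hidx⟩ := exists_addSubgroup_eq_conjKernel hℓ hM
  have h := H.card_mul_index
  rw [hidx, Nat.card_fun, Nat.card_zmod] at h
  have h6 : Nat.card {p : Fin 3 × Fin 3 // p.1 ≤ p.2} = 6 := by
    rw [Nat.card_eq_fintype_card]; decide
  rw [h6] at h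
  rw [← hH]
  exact h

end Similitude

/-! ### Expectation -/

section Probability

variable {Ω : Type*} [MeasurableSpace Ω] {μ : Measure Ω}
  {X : Ω → Matrix (Fin 3) (Fin 3) ℤ}

/-- The reductions modulo `m` of the upper-triangular entries. -/
def upperMod (m : ℕ) (X : Matrix (Fin 3) (Fin 3) ℤ) :
    {p : Fin 3 × Fin 3 // p.1 ≤ p.2} → ZMod m :=
  fun p => (X p.1.1 p.1.2 : ZMod m)

lemma measurable_upperMod {m : ℕ} (hX : IsSymmUniformMod μ 3 m X) :
    Measurable fun ω => upperMod m (X ω) :=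
  measurable_pi_lambda _ fun p => (measurable_of_countable _).comp (hX.measurable p.1.1 p.1.2)

lemma measureReal_upperMod_preimage [IsProbabilityMeasure μ] {m : ℕ} [NeZero m] (hX : IsSymmUniformMod μ 3 m X)
    (E : Set ({p : Fin 3 × Fin 3 // p.1 ≤ p.2} → ZMod m)) :
    μ.real ((fun ω => upperMod m (X ω)) ⁻¹' E) = Nat.card E * ((m : ℝ)⁻¹) ^ 6 := by
  have hsing : ∀ t, μ.real ((fun ω => upperMod m (X ω)) ⁻¹' {t}) = ((m : ℝ)⁻¹) ^ 6 := by
    intro t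
    have h := hX.indep.measure_inter_preimage_eq_mul Finset.univ (sets := fun p => {t p})
      (fun p _ => measurableSet_singleton _)
    have hset : (fun ω => upperMod m (X ω)) ⁻¹' {t} =
        ⋂ p ∈ Finset.univ, (fun (p : {p : Fin 3 × Fin 3 // p.1 ≤ p.2}) (ω : Ω) =>
          (X ω p.1.1 p.1.2 : ZMod m)) p ⁻¹' {t p} := by
      ext ω
      simp [upperMod, funext_iff]
    have hu : ∀ p : {p : Fin 3 × Fin 3 // p.1 ≤ p.2},
        μ ((fun ω => (X ω p.1.1 p.1.2 : ZMod m)) ⁻¹' {t p}) = (m : ENNReal)⁻¹ :=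
      fun p => hX.uniform p.1.1 p.1.2 p.2 (t p)
    rw [measureReal_def, hset, h, Finset.prod_congr rfl fun p _ => hu p, Finset.prod_const,
      Finset.card_univ]
    have h6 : Fintype.card {p : Fin 3 × Fin 3 // p.1 ≤ p.2} = 6 := by decide
    rw [h6]
    simp
  have hfin : E.Finite := Set.toFinite E
  have hE : (fun ω => upperMod m (X ω)) ⁻¹' E =
      ⋃ t ∈ hfin.toFinset, (fun ω => upperMod m (X ω)) ⁻¹' {t} := by
    ext ω; simp
  rw [hE, measureReal_biUnion_finset]
  · rw [Finset.sum_congr rfl fun t _ => hsing t, Finset.sum_const, nsmul_eq_mul,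
      Nat.card_coe_set_eq, Set.ncard_eq_toFinset_card _ hfin]
  · intro s _ t _ hst
    exact Set.disjoint_left.2 fun ω hs ht => hst (hs.symm.trans ht)
  · exact fun t _ => measurable_upperMod hX (measurableSet_singleton t)

lemma dvd_conj_iff_mem_conjKernel {ℓ : ℕ} {M X : Matrix (Fin 3) (Fin 3) ℤ} (hX : X.IsSymm) :
    (∀ i j, ((ℓ : ℤ) ^ 2) ∣ (M.transpose * X * M) i j) ↔ upperMod (ℓ ^ 2) X ∈ conjKernel ℓ M := by
  have hT : (modMat (ℓ ^ 2) M).transpose = modMat (ℓ ^ 2) M.transpose := rfl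
  have hX' : (modMat (ℓ ^ 2) X).IsSymm := hX.map _
  have hs : symmOfUpper (upperMod (ℓ ^ 2) X) = modMat (ℓ ^ 2) X := symmOfUpper_eq hX'
  rw [conjKernel, Set.mem_ofPred_eq, hs, hT, ← modMat_mul, ← modMat_mul, ← Matrix.ext_iff]
  refine forall_congr' fun i => forall_congr' fun j => ?_
  rw [modMat, Matrix.map_apply, Matrix.zero_apply, ZMod.intCast_zmod_eq_zero_iff_dvd]
  push_cast
  rfl

lemma conjugacyCount_eq_sum_indicator {ℓ : ℕ} (hℓ : ℓ ≠ 0) {X : Matrix (Fin 3) (Fin 3) ℤ}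
    (hX : X.IsSymm) :
    (conjugacyCount 3 ℓ X : ℝ) = ∑ M ∈ (primitiveSimilitudes_finite ℓ).toFinset,
      (conjKernel ℓ M).indicator 1 (upperMod (ℓ ^ 2) X) := by
  classical
  have hset : {M | M ∈ primitiveSimilitudes ℓ ∧
      ∀ i j, ((ℓ : ℤ) ^ 2) ∣ (M.transpose * X * M) i j} =
      (((primitiveSimilitudes_finite ℓ).toFinset.filter
        fun M => upperMod (ℓ ^ 2) X ∈ conjKernel ℓ M : Finset _) : Set _) := by
    ext M
    simp [dvd_conj_iff_mem_conjKernel hX]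
  rw [conjugacyCount_eq_ncard hℓ, hset, Set.ncard_coe_finset, Finset.card_filter]
  push_cast
  rfl

lemma integral_conjugacyCount [IsProbabilityMeasure μ] {ℓ : ℕ} (hodd : Odd ℓ) (hX : IsSymmUniformMod μ 3 (ℓ ^ 2) X) :
    Integrable (fun ω => (conjugacyCount 3 ℓ (X ω) : ℝ)) μ ∧
    ∫ ω, (conjugacyCount 3 ℓ (X ω) : ℝ) ∂μ =
      48 / (ℓ : ℝ) ^ 2 * ∏ p ∈ ℓ.primeFactors, (1 + 1 / (p : ℝ)) := by
  have hℓ : ℓ ≠ 0 := hodd.pos.ne'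
  have hlR : (ℓ : ℝ) ≠ 0 := by exact_mod_cast hℓ
  have : NeZero (ℓ ^ 2) := ⟨pow_ne_zero 2 hℓ⟩
  have hmeas := measurable_upperMod hX
  -- The count is a sum of indicators only where `X` is symmetric, hence almost everywhere;
  -- integrability and the integral are transferred from that sum.
  have hae : (fun ω => (conjugacyCount 3 ℓ (X ω) : ℝ)) =ᵐ[μ]
      fun ω => ∑ M ∈ (primitiveSimilitudes_finite ℓ).toFinset,
        ((fun ω => upperMod (ℓ ^ 2) (X ω)) ⁻¹' conjKernel ℓ M).indicator (1 : Ω → ℝ) ω := by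
    filter_upwards [hX.symm] with ω hω
    rw [conjugacyCount_eq_sum_indicator hℓ hω]
    rfl
  have hms : ∀ M, MeasurableSet ((fun ω => upperMod (ℓ ^ 2) (X ω)) ⁻¹' conjKernel ℓ M) :=
    fun M => hmeas (Set.toFinite _).measurableSet
  have hint : ∀ M ∈ (primitiveSimilitudes_finite ℓ).toFinset, Integrable
      (((fun ω => upperMod (ℓ ^ 2) (X ω)) ⁻¹' conjKernel ℓ M).indicator (1 : Ω → ℝ)) μ :=
    fun M _ => (integrable_const (1 : ℝ)).indicator (hms M)
  have hprob : ∀ M ∈ (primitiveSimilitudes_finite ℓ).toFinset,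
      ∫ ω, ((fun ω => upperMod (ℓ ^ 2) (X ω)) ⁻¹' conjKernel ℓ M).indicator (1 : Ω → ℝ) ω ∂μ =
        ((ℓ : ℝ)⁻¹) ^ 3 := by
    intro M hM
    rw [integral_indicator_one (hms M), measureReal_upperMod_preimage hX]
    have h := card_conjKernel_mul hℓ ((primitiveSimilitudes_finite ℓ).mem_toFinset.1 hM)
    have hR : (Nat.card (conjKernel ℓ M) : ℝ) * (ℓ : ℝ) ^ 3 = ((ℓ : ℝ) ^ 2) ^ 6 := by
      exact_mod_cast h
    push_cast
    field_simp
    apply mul_right_cancel₀ (pow_ne_zero 3 hlR)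
    linear_combination hR
  refine ⟨(integrable_finsetSum _ hint).congr hae.symm, ?_⟩
  rw [integral_congr_ae hae, integral_finsetSum _ hint, Finset.sum_congr rfl hprob,
    Finset.sum_const, nsmul_eq_mul, ← Set.ncard_eq_toFinset_card _ (primitiveSimilitudes_finite ℓ),
    ncard_primitiveSimilitudes hodd]
  field_simp

end Probability

theorem theorem3 (ℓ : ℕ) (hℓ : 2 ≤ ℓ) :
    ((rationalOrthogonal 3 ℓ).Nonempty ↔ Odd ℓ) ∧
    (Odd ℓ →
      (rationalOrthogonal 3 ℓ).Finite ∧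
      ∀ (Ω : Type*) [MeasurableSpace Ω] (μ : Measure Ω) [IsProbabilityMeasure μ]
        (X : Ω → Matrix (Fin 3) (Fin 3) ℤ), IsSymmUniformMod μ 3 (ℓ ^ 2) X →
        Integrable (fun ω => (conjugacyCount 3 ℓ (X ω) : ℝ)) μ ∧
        ∫ ω, (conjugacyCount 3 ℓ (X ω) : ℝ) ∂μ =
          48 / (ℓ : ℝ) ^ 2 * ∏ p ∈ ℓ.primeFactors, (1 + 1 / (p : ℝ))) := by
  have hℓ0 : ℓ ≠ 0 := by omega
  rw [rationalOrthogonal_eq_image hℓ0]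
  refine ⟨⟨fun h => ?_, fun hodd => ?_⟩, fun hodd =>
    ⟨(primitiveSimilitudes_finite ℓ).image _, fun Ω _ μ _ X hX => integral_conjugacyCount hodd hX⟩⟩
  · by_contra hodd
    rw [primitiveSimilitudes_eq_empty_of_even (Nat.not_odd_iff_even.1 hodd), Set.image_empty] at h
    exact Set.not_nonempty_empty h
  -- For odd `ℓ` the set is nonempty because its cardinality formula is positive.
  · refine Set.Nonempty.image _ (Set.nonempty_of_ncard_ne_zero fun h0 => ?_)
    have h := ncard_primitiveSimilitudes hodd
    rw [h0, Nat.cast_zero] at h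
    have : (0 : ℝ) < 48 * (ℓ * ∏ p ∈ ℓ.primeFactors, (1 + 1 / (p : ℝ))) := by
      have : (0 : ℝ) < ℓ := by exact_mod_cast hodd.pos
      have : 0 < ∏ p ∈ ℓ.primeFactors, (1 + 1 / (p : ℝ)) :=
        Finset.prod_pos fun p _ => by positivity
      positivity
    exact this.ne h
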